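/- **Setting.** Let $P$ be a probability measure on a measurable space $\mathcal X$, let $n\ge 1$, let $V$ divide $n$, and let $\tilde n=n(1-1/V)$. Let $X_0,X_1,\dots,X_n,X_1',\dots,X_n'$ be i.i.d. with law $P$, and $\mathbf X=(X_1,\dots,X_n)$. The index set $\{1,\dots,n\}$ is partitioned into the $V$ consecutive folds $I_1,\dots,I_V$ of size $n/V$; $v_i$ is the fold containing $i$, and $\mathbf X_{-v}\in\mathcal X^{\tilde n}$ is $\mathbf X$ with the entries in $I_v$ removed. For $r\in[p]$ let $\ell_r:\mathcal X\times\mathcal X^{\tilde n}\to\mathbb R$ be a measurable loss function, and put $$\hat R_{{\rm cv},r}=\frac1n\sum_{i=1}^n\ell_r(X_i;\mathbf X_{-v_i}),\qquad R_r(z)=\mathbb E\,\ell_r(X_0;z)\quad(z\in\mathcal X^{\tilde n}).$$ For a function $f$ of a sample vector, $\nabla_i f$ is $f$ minus its value after the $i$-th sample point has been replaced by its independent copy. With $Z_1,\dots,Z_{\tilde n}$ i.i.d. with law $P$, let $$\bar\ell_r(x)=\mathbb E\,\ell_r(x;Z_1,\dots,Z_{\tilde n}),\quad \bar R_r(x)=\mathbb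 E\,R_r(x,Z_2,\dots,Z_{\tilde n}),\quad \phi_{rs}=\mathrm{Cov}\big(\bar\ell_r(X_1)+\tilde n\bar R_r(X_1),\ \bar\ell_s(X_1)+\tilde n\bar R_s(X_1)\big)$$ (if $V=1$, then $\tilde n=0$ and the terms $\tilde n\bar R_r$ are absent). For $K>0$ a random variable $Y$ is called $K$-SW with constants $(a,b,\alpha)$ if $\mathbb P(|Y|/K\ge t)\le a e^{-bt^\alpha}$ for all $t>0$. **Assumptions.** Let $a,b,\alpha>0$, $\epsilon_\ell=n^{-c_\ell}$ with $c_\ell\in(0,1/2]$, and $\epsilon_R>0$. Suppose that for all $r\in[p]$: (i) $\ell_r(x_0;x_1,\dots,x_{\tilde n})$ is symmetric in $(x_1,\dots,x_{\tilde n})$; and that, with the same constants $(a,b,\alpha)$, (ii) $\nabla_i\ell_r(X_0;\mathbf X_{-1})$ is $n^{-1/2}\epsilon_\ell$-SW for all $i\in[\tilde n]$; (iii) $\nabla_j\nabla_i\ell_r(X_0;\mathbf X_{-1})$ is $n^{-3/2}\epsilon_\ell$-SW for all $1\le i<j\le\tilde n$; (iv) $\ell_r(X_0;\mathbf X_{-1})$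 is $1$-SW; (v) $\nabla_iR_r(\mathbf X_{-1})$ is $n^{-1}\epsilon_R$-SW for all $i\in[\tilde n]$. In (ii), (iii) and (v) the operators $\nabla_i,\nabla_j$ act on the $i$-th and $j$-th entries of the training sample $\mathbf X_{-1}$. **Theorem.** There are constants $C,c_2>0$ and, for every $\kappa>0$, a constant $c_1(\kappa)>0$, all depending only on $(a,b,\alpha)$ (and $\kappa$), such that in every setting as above and for every $i\in[n]$ the functions $\bar\ell_r+\tilde n\bar R_r$ are in $L^2(P)$, the products $\nabla_i\hat R_{{\rm cv},r}\nabla_i\hat R_{{\rm cv},s}$ are integrable, and: 1. for all $r,s\in[p]$, $$\left|\frac{n^2}{2}\mathbb E\big[\nabla_i\hat R_{{\rm cv},r}\nabla_i\hat R_{{\rm cv},s}\big]-\phi_{rs}\right|\le C\,\epsilon_\ell(1+\epsilon_R);$$ 2. for every $\kappa>0$, with probability at least $1-(n+p)^{-\kappa}$, simultaneously for all $r,s\in[p]$, $$n^2\left|\mathbb E\big[\nabla_i\hat R_{{\rm cv},r}\nabla_i\hat R_{{\rm cv},s}\,\big|\,\mathbf X_{-v_i}\big]-\mathbb E\big[\nabla_i\hat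 R_{{\rm cv},r}\nabla_i\hat R_{{\rm cv},s}\big]\right|\le c_1(\kappa)\log^{c_2}(n+p)\,\epsilon_\ell(1+\epsilon_R);$$ 3. for every $\kappa>0$, with probability at least $1-(n+p)^{-\kappa}$, simultaneously for all $r,s\in[p]$, $$\left|\frac{n^2}{2}\mathbb E\big[\nabla_i\hat R_{{\rm cv},r}\nabla_i\hat R_{{\rm cv},s}\,\big|\,\mathbf X_{-v_i}\big]-\phi_{rs}\right|\le c_1(\kappa)\log^{c_2}(n+p)\,\epsilon_\ell(1+\epsilon_R).$$ -/

import Mathlib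

open MeasureTheory ProbabilityTheory

/-- The random variable `Y` is `K`-sub-Weibull with tail constants `a, b, α`. -/
def SubWeibull {Ω : Type*} [MeasurableSpace Ω] (μ : Measure Ω) (a b α K : ℝ) (Y : Ω → ℝ) : Prop :=
  ∀ t : ℝ, 0 < t → μ.real {ω | t ≤ |Y ω| / K} ≤ a * Real.exp (-b * t ^ α)

/-- The size `n (1 - 1 / V)` of a training sample in `V`-fold cross-validation (for `V ∣ n`). -/
def trainSize (n V : ℕ) : ℕ := n - n / V

/-- The (zero-based) fold containing the index `i`: fold `v` consists of the `i` with
`v * (n / V) ≤ i < (v + 1) * (n / V)`. -/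
def foldOf {n : ℕ} (V : ℕ) (i : Fin n) : ℕ := i.val / (n / V)

/-- The increasing enumeration of the indices that do not belong to fold `v`. -/
def trainIdx (n V v : ℕ) (k : Fin (trainSize n V)) : Fin n :=
  if k.val < v * (n / V) then
    ⟨k.val, lt_of_lt_of_le k.isLt (Nat.sub_le n (n / V))⟩
  else
    ⟨k.val + n / V, Nat.add_lt_of_lt_sub k.isLt⟩

/-- The subvector of `x` with fold `v` removed. -/
def dropFold {𝒳 : Type*} {n : ℕ} (V v : ℕ) (x : Fin n → 𝒳) : Fin (trainSize n V) → 𝒳 :=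
  fun k => x (trainIdx n V v k)

/-- The `V`-fold cross-validated risk of the loss `L` on the data `x`. -/
noncomputable def cvRisk {𝒳 : Type*} {n : ℕ} (V : ℕ)
    (L : 𝒳 → (Fin (trainSize n V) → 𝒳) → ℝ) (x : Fin n → 𝒳) : ℝ :=
  (n : ℝ)⁻¹ * ∑ i : Fin n, L (x i) (dropFold V (foldOf V i) x)

/-- The difference operator `∇ᵢ f = f(x) - f(xⁱ)`, where `xⁱ` is `x` with its `i`-th entry
replaced by `x'ᵢ`. -/
def nabla {𝒳 : Type*} {N : ℕ} (x' : Fin N → 𝒳) (i : Fin N) (f : (Fin N → 𝒳) → ℝ) :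
    (Fin N → 𝒳) → ℝ :=
  fun x => f x - f (Function.update x i (x' i))

/-- The risk `R(z) = 𝔼 L(X₀; z)`, with `X₀ ∼ P`, of the model fitted on the training sample `z`. -/
noncomputable def risk {𝒳 : Type*} [MeasurableSpace 𝒳] {N : ℕ} (P : Measure 𝒳)
    (L : 𝒳 → (Fin N → 𝒳) → ℝ) (z : Fin N → 𝒳) : ℝ :=
  ∫ x₀, L x₀ z ∂P

/-- The loss at `x` averaged over an i.i.d. training sample: `𝔼 L(x; Z₁, …, Z_N)`. -/
noncomputable def avgLoss {𝒳 : Type*} [MeasurableSpace 𝒳] {N : ℕ} (P : Measure 𝒳)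
    (L : 𝒳 → (Fin N → 𝒳) → ℝ) (x : 𝒳) : ℝ :=
  ∫ z, L x z ∂(Measure.pi fun _ : Fin N => P)

/-- The risk of a training sample, one of whose points is `x` while the others are i.i.d.:
`𝔼 R(x, Z₂, …, Z_N)`. The position of `x` is immaterial for a symmetric loss. -/
noncomputable def avgRisk {𝒳 : Type*} [MeasurableSpace 𝒳] {N : ℕ} (P : Measure 𝒳)
    (L : 𝒳 → (Fin N → 𝒳) → ℝ) (x : 𝒳) : ℝ :=
  ∫ z, risk P L (fun k => if k.val = 0 then x else z k) ∂(Measure.pi fun _ : Fin N => P)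

/-- The contribution of a single sample point to the fluctuation of `n R̂_cv`. -/
noncomputable def influence {𝒳 : Type*} [MeasurableSpace 𝒳] {N : ℕ} (P : Measure 𝒳)
    (L : 𝒳 → (Fin N → 𝒳) → ℝ) (x : 𝒳) : ℝ :=
  avgLoss P L x + (N : ℝ) * avgRisk P L x

/-- The covariance `φ_{rs}` of the Gaussian limit under deterministic centering. -/
noncomputable def phi {𝒳 : Type*} [MeasurableSpace 𝒳] {N p : ℕ} (P : Measure 𝒳)
    (L : Fin p → 𝒳 → (Fin N → 𝒳) → ℝ) (r s : Fin p) : ℝ :=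
  cov[influence P (L r), influence P (L s); P]

/-- `X₀`, the data `X` and the replacements `X'` are all independent with common law `P`. -/
structure IsIIDSample {Ω 𝒳 : Type*} [MeasurableSpace Ω] [MeasurableSpace 𝒳] {n : ℕ}
    (μ : Measure Ω) (P : Measure 𝒳) (X₀ : Ω → 𝒳) (X X' : Fin n → Ω → 𝒳) : Prop where
  measurable_zero : Measurable X₀
  measurable_data : ∀ i, Measurable (X i)
  measurable_copy : ∀ i, Measurable (X' i)
  law_zero : μ.map X₀ = P
  law_data : ∀ i, μ.map (X i) = P
  law_copy : ∀ i, μ.map (X' i) = P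
  indep : iIndepFun (fun k : Option (Fin n ⊕ Fin n) => k.elim X₀ (Sum.elim X X')) μ

/-- Measurability and symmetry of the losses, first and second order stability and tails of the
losses at scale `εl`, and stability of the risks at scale `εR`; all sub-Weibull tails have the
common constants `a, b, α`. -/
structure IsStableLoss {Ω 𝒳 : Type*} [MeasurableSpace Ω] [MeasurableSpace 𝒳] {n p : ℕ} (V : ℕ)
    (μ : Measure Ω) (P : Measure 𝒳) (X₀ : Ω → 𝒳) (X X' : Fin n → Ω → 𝒳)
    (L : Fin p → 𝒳 → (Fin (trainSize n V) → 𝒳) → ℝ) (a b α εl εR : ℝ) : Prop where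
  measurable_loss : ∀ r, Measurable (Function.uncurry (L r))
  symmetric : ∀ r x₀ z (σ : Equiv.Perm (Fin (trainSize n V))), L r x₀ (z ∘ σ) = L r x₀ z
  loss_first_order : ∀ r i, SubWeibull μ a b α ((n : ℝ) ^ (-(1 / 2) : ℝ) * εl) fun ω =>
    nabla (dropFold V 0 fun k => X' k ω) i (L r (X₀ ω)) (dropFold V 0 fun k => X k ω)
  loss_second_order : ∀ r i j, i < j →
    SubWeibull μ a b α ((n : ℝ) ^ (-(3 / 2) : ℝ) * εl) fun ω =>
      nabla (dropFold V 0 fun k => X' k ω) j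
        (nabla (dropFold V 0 fun k => X' k ω) i (L r (X₀ ω))) (dropFold V 0 fun k => X k ω)
  loss_tail : ∀ r, SubWeibull μ a b α 1 fun ω => L r (X₀ ω) (dropFold V 0 fun k => X k ω)
  risk_first_order : ∀ r i, SubWeibull μ a b α ((n : ℝ)⁻¹ * εR) fun ω =>
    nabla (dropFold V 0 fun k => X' k ω) i (risk P (L r)) (dropFold V 0 fun k => X k ω)

/-- The random variable `∇ᵢ R̂_cv`. -/
noncomputable def nablaCV {Ω 𝒳 : Type*} {n : ℕ} (V : ℕ) (X X' : Fin n → Ω → 𝒳)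
    (L : 𝒳 → (Fin (trainSize n V) → 𝒳) → ℝ) (i : Fin n) (ω : Ω) : ℝ :=
  nabla (fun k => X' k ω) i (cvRisk V L) (fun k => X k ω)

/-- The `σ`-algebra generated by the data outside the fold of `i`. -/
abbrev trainSigma {Ω 𝒳 : Type*} [MeasurableSpace 𝒳] {n : ℕ} (V : ℕ) (X : Fin n → Ω → 𝒳)
    (i : Fin n) : MeasurableSpace Ω :=
  MeasurableSpace.comap (fun ω => dropFold V (foldOf V i) fun k => X k ω) inferInstance

open scoped ENNReal

/-! Everything follows from a linearization. Let `H_r = influence(X_i) - influence(X'_i)` for the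
loss `L r`. The claim behind the three bounds is that `n ∇ᵢ R̂_cv,r` equals `H_r` up to an error
whose `2k`-norm is at most a power of `k` times `εl`.

Replacing `X_i` changes the cross-validated risk in two ways (`mul_nabla_cvRisk`). As a test point,
`X_i` is evaluated on a model not trained on it; that loss concentrates around `avgLoss`, with
fluctuation of order `√n · n^{-1/2} εl` by first order stability. As a training point, `X_i` enters
the losses of all folds but its own; their total change (`crossTerm`) has conditional mean `ñ
(avgRisk(X_i) - avgRisk(X'_i))` given `X_i, X'_i`. By second order stability, resampling another
point moves it by only `n^{-1/2} εl`, so its fluctuation is again of order `εl`. Both concentration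
statements are instances of a moment version of the Efron–Stein inequality,
`eLpNorm_sub_integral_pi_le`, proved by adding martingale differences one coordinate at a time.

The products then satisfy `n² ∇ᵢR̂_r ∇ᵢR̂_s = H_r H_s + productError`, where the `k`-norm of the
error is at most a power of `k` times `εl (1 + εR)` (`IsStableLoss.eLpNorm_productError_le`). Now
`H_r H_s` depends only on `(X_i, X'_i)`, which is independent of `X_{-v_i}`, so its conditional and
unconditional means are both `2 φ_rs`. All three deviations are therefore conditional or plain means
of `productError`. The plain mean is bounded by the 1-norm. The conditional mean is a contraction in
the `k`-norm, and Markov's inequality with `k` of order `log(n+p)` and a union bound over the pairs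
`(r, s)` give the high-probability bounds. -/

/-! ### Elementary inequalities for even powers. -/

theorem abs_pow_mul_abs_pow_le (u w : ℝ) (i j : ℕ) :
    |w| ^ i * |u| ^ j ≤ |u| ^ (i + j) + |w| ^ (i + j) := by
  rcases le_total |w| |u| with h | h
  · calc |w| ^ i * |u| ^ j ≤ |u| ^ i * |u| ^ j := by gcongr
      _ = |u| ^ (i + j) := (pow_add _ _ _).symm
      _ ≤ _ := le_add_of_nonneg_right (by positivity)
  · calc |w| ^ i * |u| ^ j ≤ |w| ^ i * |w| ^ j := by gcongr
      _ = |w| ^ (i + j) := (pow_add _ _ _).symm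
      _ ≤ _ := le_add_of_nonneg_left (by positivity)

/-- A second order Taylor bound for an even power. -/
theorem add_mul_pow_even_le {k : ℕ} (hk : 1 ≤ k) (u w : ℝ) {x : ℝ} (hx : 0 ≤ x) :
    (u + x * w) ^ (2 * k) ≤ u ^ (2 * k) + 2 * k * (u ^ (2 * k - 1) * (x * w))
      + ((1 + x) ^ (2 * k) - 1 - 2 * k * x) * (u ^ (2 * k) + w ^ (2 * k)) := by
  obtain ⟨l, rfl⟩ : ∃ l, k = l + 1 := ⟨k - 1, by omega⟩
  have hn : 2 * (l + 1) = 2 * l + 1 + 1 := by ring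
  have hu : u ^ (2 * (l + 1)) = |u| ^ (2 * (l + 1)) := by
    rw [pow_mul, pow_mul, sq_abs]
  have hw : w ^ (2 * (l + 1)) = |w| ^ (2 * (l + 1)) := by
    rw [pow_mul, pow_mul, sq_abs]
  have e1 := add_pow (x * w) u (2 * (l + 1))
  have e2 := add_pow x 1 (2 * (l + 1))
  rw [hn, Finset.sum_range_succ', Finset.sum_range_succ', ← hn] at e1 e2
  -- In the binomial terms of degree at least 2 in `x`, each mixed monomial in `u, w` is at most
  -- `u^{2k} + w^{2k}`; what remains is the tail of the expansion of `(1 + x)^{2k}`.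
  have key : ∑ m ∈ Finset.range (2 * l + 1), (x * w) ^ (m + 1 + 1) *
        u ^ (2 * (l + 1) - (m + 1 + 1)) * ((2 * (l + 1)).choose (m + 1 + 1) : ℝ)
      ≤ (∑ m ∈ Finset.range (2 * l + 1), x ^ (m + 1 + 1) *
        1 ^ (2 * (l + 1) - (m + 1 + 1)) * ((2 * (l + 1)).choose (m + 1 + 1) : ℝ))
        * (u ^ (2 * (l + 1)) + w ^ (2 * (l + 1))) := by
    rw [Finset.sum_mul]
    refine Finset.sum_le_sum fun m hm => ?_
    have hm' : m < 2 * l + 1 := Finset.mem_range.1 hm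
    have h1 := abs_pow_mul_abs_pow_le u w (m + 1 + 1) (2 * (l + 1) - (m + 1 + 1))
    rw [show m + 1 + 1 + (2 * (l + 1) - (m + 1 + 1)) = 2 * (l + 1) by omega, ← hu, ← hw] at h1
    have h2 : w ^ (m + 1 + 1) * u ^ (2 * (l + 1) - (m + 1 + 1)) ≤
        u ^ (2 * (l + 1)) + w ^ (2 * (l + 1)) := by
      refine le_trans (le_abs_self _) ?_
      rwa [abs_mul, abs_pow, abs_pow]
    rw [mul_pow, one_pow, mul_one]
    calc _ = x ^ (m + 1 + 1) * ((2 * (l + 1)).choose (m + 1 + 1) : ℝ) *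
          (w ^ (m + 1 + 1) * u ^ (2 * (l + 1) - (m + 1 + 1))) := by ring
      _ ≤ _ := by gcongr
  have h3 : (1 + x) ^ (2 * (l + 1)) - 1 - 2 * ((l + 1 : ℕ) : ℝ) * x =
      ∑ m ∈ Finset.range (2 * l + 1), x ^ (m + 1 + 1) *
        1 ^ (2 * (l + 1) - (m + 1 + 1)) * ((2 * (l + 1)).choose (m + 1 + 1) : ℝ) := by
    rw [add_comm 1 x, e2]
    simp
    ring
  rw [h3, add_comm u, e1]
  have h4 : (x * w) ^ (0 + 1) * u ^ (2 * (l + 1) - (0 + 1)) * ((2 * (l + 1)).choose (0 + 1) : ℝ) +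
      (x * w) ^ 0 * u ^ (2 * (l + 1) - 0) * ((2 * (l + 1)).choose 0 : ℝ) =
      u ^ (2 * (l + 1)) + 2 * ((l + 1 : ℕ) : ℝ) * (u ^ (2 * (l + 1) - 1) * (x * w)) := by
    simp
    ring
  linarith

/-- The remainder is quadratic because `(1 + x)^{2k} ≤ e^y` with `y = 2kx`, and `e^y - 1 - y ≤ y²`
for `|y| ≤ 1`. -/
theorem one_add_pow_sub_le {k : ℕ} {x : ℝ} (hx : 0 ≤ x) (hkx : 2 * k * x ≤ 1) :
    (1 + x) ^ (2 * k) - 1 - 2 * k * x ≤ (2 * k * x) ^ 2 := by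
  have h1 : (1 + x) ^ (2 * k) ≤ Real.exp (2 * k * x) := by
    calc (1 + x) ^ (2 * k) ≤ Real.exp x ^ (2 * k) := by
          gcongr; linarith [Real.add_one_le_exp x]
      _ = Real.exp (2 * k * x) := by rw [← Real.exp_nat_mul]; push_cast; rfl
  have h2 := Real.abs_exp_sub_one_sub_id_le (x := 2 * k * x)
    (by rw [abs_of_nonneg (by positivity)]; exact hkx)
  linarith [(abs_le.1 h2).2]

/-! ### Even moments, one martingale step, and Jensen's inequality. -/

section Moments

variable {Ω : Type*} [MeasurableSpace Ω] {μ : Measure Ω}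

theorem MeasureTheory.MemLp.integrable_pow_even {f : Ω → ℝ} {k : ℕ} (hk : 1 ≤ k)
    (hf : MemLp f ((2 * k : ℕ) : ℝ≥0∞) μ) : Integrable (fun ω => f ω ^ (2 * k)) μ := by
  have := hf.integrable_norm_pow (by omega)
  refine this.congr (Filter.Eventually.of_forall fun ω => ?_)
  simp [pow_mul]

theorem eLpNorm_even_le_iff {f : Ω → ℝ} {k : ℕ} (hk : 1 ≤ k)
    (hf : MemLp f ((2 * k : ℕ) : ℝ≥0∞) μ) {B : ℝ} (hB : 0 ≤ B) :
    eLpNorm f ((2 * k : ℕ) : ℝ≥0∞) μ ≤ ENNReal.ofReal B ↔ ∫ ω, f ω ^ (2 * k) ∂μ ≤ B ^ (2 * k) := by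
  have h0 : ((2 * k : ℕ) : ℝ≥0∞) ≠ 0 := by simp; omega
  have hkpos : (0 : ℝ) < ((2 * k : ℕ) : ℝ) := by exact_mod_cast (by omega : 0 < 2 * k)
  rw [hf.eLpNorm_eq_integral_rpow_norm h0 (ENNReal.natCast_ne_top _), ENNReal.toReal_natCast,
    ENNReal.ofReal_le_ofReal_iff hB]
  have h1 : ∫ ω, ‖f ω‖ ^ ((2 * k : ℕ) : ℝ) ∂μ = ∫ ω, f ω ^ (2 * k) ∂μ := by
    refine integral_congr_ae (Filter.Eventually.of_forall fun ω => ?_)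
    simp only [Real.rpow_natCast]
    simp [pow_mul]
  rw [h1]
  have h2 : 0 ≤ ∫ ω, f ω ^ (2 * k) ∂μ :=
    integral_nonneg fun ω => (even_two_mul k).pow_nonneg _
  rw [Real.rpow_inv_le_iff_of_pos h2 hB hkpos, Real.rpow_natCast]

/-- One step of the moment bound for sums of martingale differences. -/
theorem integral_add_pow_even_le {k : ℕ} (hk : 1 ≤ k) {S d : Ω → ℝ} {A b : ℝ} (hb : 0 < b)
    (hbA : 2 * k * b ≤ A)
    (hS : MemLp S ((2 * k : ℕ) : ℝ≥0∞) μ) (hd : MemLp d ((2 * k : ℕ) : ℝ≥0∞) μ)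
    (hSA : ∫ ω, S ω ^ (2 * k) ∂μ ≤ A ^ (2 * k)) (hdb : ∫ ω, d ω ^ (2 * k) ∂μ ≤ b ^ (2 * k))
    (hSd : Integrable (fun ω => S ω ^ (2 * k - 1) * d ω) μ)
    (h0 : ∫ ω, S ω ^ (2 * k - 1) * d ω ∂μ = 0) :
    ∫ ω, (S ω + d ω) ^ (2 * k) ∂μ ≤ (A ^ 2 + 8 * k * b ^ 2) ^ k := by
  have hk' : (1 : ℝ) ≤ k := by exact_mod_cast hk
  have hA : 0 < A := lt_of_lt_of_le (by positivity) hbA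
  have hSi := hS.integrable_pow_even hk
  have hdi := hd.integrable_pow_even hk
  have hsum := (hS.add hd).integrable_pow_even hk
  -- `S` is normalized by `A` and `d` by `b`, so that both `2k`-th moments in the Taylor remainder
  -- are at most 1; the linear term integrates to zero by `h0`.
  set x := b / A with hx
  have hx0 : 0 ≤ x := by positivity
  set η := (1 + x) ^ (2 * k) - 1 - 2 * k * x with hη
  have hkx : 2 * k * x ≤ 1 := by
    rw [hx, ← mul_div_assoc, div_le_one hA]; exact hbA
  have hη1 : η ≤ (2 * k * x) ^ 2 := one_add_pow_sub_le hx0 hkx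
  have hη0 : 0 ≤ η := by
    have := one_add_mul_le_pow (a := x) (by linarith) (2 * k)
    push_cast at this
    simp only [hη]; linarith
  have hpt : ∀ ω, (S ω + d ω) ^ (2 * k) ≤ (1 + η) * S ω ^ (2 * k) +
      2 * k * (S ω ^ (2 * k - 1) * d ω) + η * A ^ (2 * k) / b ^ (2 * k) * d ω ^ (2 * k) := by
    intro ω
    have h := add_mul_pow_even_le hk (S ω / A) (d ω / b) hx0
    have hxw : x * (d ω / b) = d ω / A := by rw [hx]; field_simp
    rw [hxw, ← add_div, div_pow, div_pow, div_pow, div_pow, ← hη] at h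
    have h' := mul_le_mul_of_nonneg_left h (pow_nonneg hA.le (2 * k))
    have hA2 : A ^ (2 * k) = A ^ (2 * k - 1) * A := by
      rw [← pow_succ]; congr 1; omega
    calc (S ω + d ω) ^ (2 * k) = A ^ (2 * k) * ((S ω + d ω) ^ (2 * k) / A ^ (2 * k)) := by
          field_simp
      _ ≤ _ := h'
      _ = _ := by
          rw [hA2]; field_simp; ring
  have hint : ∫ ω, (S ω + d ω) ^ (2 * k) ∂μ ≤ (1 + η) * ∫ ω, S ω ^ (2 * k) ∂μ +
      2 * k * ∫ ω, S ω ^ (2 * k - 1) * d ω ∂μ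
      + η * A ^ (2 * k) / b ^ (2 * k) * ∫ ω, d ω ^ (2 * k) ∂μ := by
    refine (integral_mono hsum (((hSi.const_mul _).add (hSd.const_mul _)).add (hdi.const_mul _))
      hpt).trans_eq ?_
    rw [integral_add' ((hSi.const_mul _).add (hSd.const_mul _)) (hdi.const_mul _),
      integral_add' (hSi.const_mul _) (hSd.const_mul _), integral_const_mul, integral_const_mul,
      integral_const_mul]
  rw [h0, mul_zero, add_zero] at hint
  have h5 : η * A ^ (2 * k) / b ^ (2 * k) * ∫ ω, d ω ^ (2 * k) ∂μ ≤ η * A ^ (2 * k) := by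
    calc _ ≤ η * A ^ (2 * k) / b ^ (2 * k) * b ^ (2 * k) := by gcongr
      _ = _ := by field_simp
  have h6 : (1 + η) * ∫ ω, S ω ^ (2 * k) ∂μ ≤ (1 + η) * A ^ (2 * k) := by gcongr
  -- Bernoulli's inequality turns the growth of the `2k`-th moment into growth of the squared scale:
  -- `A²` increases by `8kb²` per step, whence the square-root dependence on the number of steps.
  have h7 : 1 + (k : ℝ) * (8 * k * x ^ 2) ≤ (1 + 8 * k * x ^ 2) ^ k :=
    one_add_mul_le_pow (by nlinarith [sq_nonneg x]) k
  have h8 : (A ^ 2 + 8 * k * b ^ 2) ^ k = A ^ (2 * k) * (1 + 8 * k * x ^ 2) ^ k := by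
    rw [pow_mul, ← mul_pow, hx]; congr 1; field_simp
  rw [h8]
  calc _ ≤ A ^ (2 * k) * (1 + 2 * η) := by linarith
    _ ≤ A ^ (2 * k) * (1 + (k : ℝ) * (8 * k * x ^ 2)) := by
        gcongr A ^ (2 * k) * ?_; nlinarith
    _ ≤ _ := by gcongr

theorem MeasureTheory.MemLp.integrable_pow_sub_one_mul {k : ℕ} (hk : 1 ≤ k) {S d : Ω → ℝ}
    (hS : MemLp S ((2 * k : ℕ) : ℝ≥0∞) μ) (hd : MemLp d ((2 * k : ℕ) : ℝ≥0∞) μ) :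
    Integrable (fun ω => S ω ^ (2 * k - 1) * d ω) μ := by
  refine ((hS.integrable_pow_even hk).add (hd.integrable_pow_even hk)).mono'
    ((hS.1.pow _).mul hd.1) (Filter.Eventually.of_forall fun ω => ?_)
  have h := abs_pow_mul_abs_pow_le (d ω) (S ω) (2 * k - 1) 1
  rw [show 2 * k - 1 + 1 = 2 * k by omega, pow_one] at h
  simp only [Pi.add_apply, Real.norm_eq_abs, abs_mul, abs_pow]
  rw [pow_mul |d ω|, pow_mul |S ω|, sq_abs, sq_abs, ← pow_mul, ← pow_mul] at h
  linarith

/-- Jensen's inequality for integration over one factor of a product. -/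
theorem eLpNorm_integral_prod_right_le {α' : Type*} [MeasurableSpace α'] {ν : Measure α'}
    [IsProbabilityMeasure ν] [SFinite μ] {f : Ω × α' → ℝ} (hf : AEStronglyMeasurable f (μ.prod ν))
    {q : ℕ} (hq : 1 ≤ q) :
    eLpNorm (fun ω => ∫ z, f (ω, z) ∂ν) q μ ≤ eLpNorm f q (μ.prod ν) := by
  have h0 : (q : ℝ≥0∞) ≠ 0 := by simp; omega
  have h1 : (1 : ℝ≥0∞) ≤ q := by exact_mod_cast hq
  have hqpos : (0 : ℝ) < q := by exact_mod_cast (by omega : 0 < q)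
  rw [eLpNorm_eq_lintegral_rpow_enorm_toReal h0 (ENNReal.natCast_ne_top _),
    eLpNorm_eq_lintegral_rpow_enorm_toReal h0 (ENNReal.natCast_ne_top _), ENNReal.toReal_natCast]
  refine ENNReal.rpow_le_rpow ?_ (by positivity)
  rw [lintegral_prod _ (hf.enorm.pow_const _)]
  refine lintegral_mono_ae ?_
  filter_upwards [hf.prodMk_left] with ω hω
  have h2 : ‖∫ z, f (ω, z) ∂ν‖ₑ ≤ eLpNorm (fun z => f (ω, z)) q ν :=
    (enorm_integral_le_lintegral_enorm _).trans
      (by rw [← eLpNorm_one_eq_lintegral_enorm]; exact eLpNorm_le_eLpNorm_of_exponent_le h1 hω)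
  refine (ENNReal.rpow_le_rpow h2 hqpos.le).trans_eq ?_
  rw [eLpNorm_eq_lintegral_rpow_enorm_toReal h0 (ENNReal.natCast_ne_top _), ENNReal.toReal_natCast,
    ← ENNReal.rpow_mul, one_div, inv_mul_cancel₀ hqpos.ne', ENNReal.rpow_one]

theorem MeasureTheory.MemLp.integral_prod_right {α' : Type*} [MeasurableSpace α'] {ν : Measure α'}
    [IsProbabilityMeasure ν] [SFinite μ] {f : Ω × α' → ℝ} {q : ℕ} (hq : 1 ≤ q)
    (hf : MemLp f q (μ.prod ν)) : MemLp (fun ω => ∫ z, f (ω, z) ∂ν) q μ :=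
  ⟨hf.1.integral_prod_right', (eLpNorm_integral_prod_right_le hf.1 hq).trans_lt hf.2⟩

end Moments

/-! ### Moments of sub-Weibull variables. -/

theorem eLpNorm_le_ofReal_of_lintegral_le {Ω : Type*} [MeasurableSpace Ω] {μ : Measure Ω}
    {f : Ω → ℝ} {q : ℕ} (hq : 1 ≤ q) {B : ℝ} (hB : 0 ≤ B)
    (h : ∫⁻ ω, ‖f ω‖ₑ ^ q ∂μ ≤ ENNReal.ofReal (B ^ q)) : eLpNorm f q μ ≤ ENNReal.ofReal B := by
  have h0 : (q : ℝ≥0∞) ≠ 0 := by simp; omega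
  have hqpos : (0 : ℝ) < q := by exact_mod_cast (by omega : 0 < q)
  rw [eLpNorm_eq_lintegral_rpow_enorm_toReal h0 (ENNReal.natCast_ne_top _), ENNReal.toReal_natCast]
  simp only [ENNReal.rpow_natCast]
  refine (ENNReal.rpow_le_rpow h (by positivity)).trans_eq ?_
  rw [ENNReal.ofReal_pow hB, ← ENNReal.rpow_natCast, ← ENNReal.rpow_mul,
    mul_one_div_cancel hqpos.ne', ENNReal.rpow_one]

section SubWeibull

variable {Ω : Type*} [MeasurableSpace Ω] {μ : Measure Ω} [IsProbabilityMeasure μ]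
  {a b α K : ℝ} {Y : Ω → ℝ}

/-- Layer-cake formula. Halving the rate `b` makes the tail of the exponential at `t > 1` at most `a
t⁻²`, whose integral is `a`; the interval `(0, 1]` contributes at most 1. -/
theorem SubWeibull.lintegral_exp_le (ha : 0 < a) (hb : 0 < b) (hα : 0 < α)
    (hY : Measurable Y) (h : SubWeibull μ a b α K Y) (hK : 0 < K) :
    ∫⁻ ω, ENNReal.ofReal (Real.exp (b / 2 * (|Y ω| / K) ^ α)) ∂μ ≤ ENNReal.ofReal (1 + a) := by
  have hm : Measurable fun ω => Real.exp (b / 2 * (|Y ω| / K) ^ α) := by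
    fun_prop
  rw [lintegral_eq_lintegral_meas_le μ (Filter.Eventually.of_forall fun ω => (Real.exp_pos _).le)
    hm.aemeasurable]
  rw [← Set.Ioc_union_Ioi_eq_Ioi (zero_le_one (α := ℝ))]
  refine (lintegral_union_le _ _ _).trans ?_
  rw [ENNReal.ofReal_add zero_le_one ha.le]
  gcongr
  · calc _ ≤ ∫⁻ _ in Set.Ioc (0 : ℝ) 1, (1 : ℝ≥0∞) := by
          exact lintegral_mono fun t => prob_le_one
      _ = _ := by simp
  · have htail : ∀ t ∈ Set.Ioi (1 : ℝ), μ {ω | t ≤ Real.exp (b / 2 * (|Y ω| / K) ^ α)} ≤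
        ENNReal.ofReal (a * t ^ (-2 : ℝ)) := by
      intro t ht
      have ht1 : 1 < t := ht
      have hlog : 0 < Real.log t := Real.log_pos ht1
      have hs := h ((2 / b * Real.log t) ^ α⁻¹) (by positivity)
      rw [← Real.rpow_mul (by positivity), inv_mul_cancel₀ hα.ne', Real.rpow_one] at hs
      have he : Real.exp (-b * (2 / b * Real.log t)) = t ^ (-2 : ℝ) := by
        rw [Real.rpow_def_of_pos (by linarith)]
        congr 1; field_simp
      rw [he] at hs
      rw [← ENNReal.ofReal_toReal (measure_ne_top μ _)]
      refine ENNReal.ofReal_le_ofReal (le_trans ?_ hs)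
      refine ENNReal.toReal_mono (measure_ne_top μ _) (measure_mono fun ω hω => ?_)
      simp only [Set.mem_ofPred_eq] at hω ⊢
      rw [← Real.log_le_iff_le_exp (by linarith)] at hω
      have hy : 0 ≤ |Y ω| / K := by positivity
      calc (2 / b * Real.log t) ^ α⁻¹ ≤ ((|Y ω| / K) ^ α) ^ α⁻¹ := by
            apply Real.rpow_le_rpow (by positivity) _ (by positivity)
            rw [div_mul_eq_mul_div, div_le_iff₀ hb]; linarith
        _ = |Y ω| / K := by rw [← Real.rpow_mul hy, mul_inv_cancel₀ hα.ne', Real.rpow_one]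
    refine (setLIntegral_mono' measurableSet_Ioi htail).trans ?_
    rw [← ofReal_integral_eq_lintegral_ofReal]
    · rw [integral_const_mul, integral_Ioi_rpow_of_lt (by norm_num) zero_lt_one]
      norm_num
    · exact (integrableOn_Ioi_rpow_of_lt (by norm_num) zero_lt_one).const_mul a
    · refine (ae_restrict_iff' measurableSet_Ioi).2 (Filter.Eventually.of_forall fun t ht => ?_)
      have : (0 : ℝ) < t := lt_trans zero_lt_one ht
      positivity

/-- The growth of the moments of sub-Weibull variables. -/
noncomputable def weibullMoment (a b α : ℝ) (q : ℕ) : ℝ :=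
  (1 + a) * (2 * q / (α * b)) ^ α⁻¹

theorem weibullMoment_nonneg (ha : 0 < a) (hb : 0 < b) (hα : 0 < α) (q : ℕ) :
    0 ≤ weibullMoment a b α q := by
  unfold weibullMoment; positivity

theorem rpow_le_mul_exp {u r c : ℝ} (hu : 0 ≤ u) (hr : 0 < r) (hc : 0 < c) :
    u ^ r ≤ (r / c) ^ r * Real.exp (c * u) := by
  have h1 : u ≤ r / c * Real.exp (c * u / r) := by
    have h2 := Real.add_one_le_exp (c * u / r)
    calc u = r / c * (c * u / r) := by field_simp
      _ ≤ _ := by gcongr; linarith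
  calc u ^ r ≤ (r / c * Real.exp (c * u / r)) ^ r := by gcongr
    _ = _ := by
      rw [Real.mul_rpow (by positivity) (by positivity), ← Real.exp_mul]
      congr 2; field_simp

/-- With `u = (|Y|/K)^α`, the power `u^{q/α}` is absorbed by `e^{bu/2}` at the cost of a factor
`(2q/(αb))^{q/α}`. Using `1 + a ≤ (1 + a)^q` gives a `q`-th power exactly, so the norm grows like
`q^{1/α}`. -/
theorem SubWeibull.eLpNorm_le (ha : 0 < a) (hb : 0 < b) (hα : 0 < α)
    (hY : Measurable Y) (h : SubWeibull μ a b α K Y) (hK : 0 < K) {q : ℕ} (hq : 1 ≤ q) :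
    eLpNorm Y q μ ≤ ENNReal.ofReal (K * weibullMoment a b α q) := by
  have hqpos : (0 : ℝ) < q := by exact_mod_cast (by omega : 0 < q)
  refine eLpNorm_le_ofReal_of_lintegral_le hq
    (mul_nonneg hK.le (weibullMoment_nonneg ha hb hα q)) ?_
  set M := 2 * q / (α * b) with hM
  have hM0 : 0 < M := by positivity
  have hpt : ∀ ω, ‖Y ω‖ₑ ^ q ≤ ENNReal.ofReal (K ^ q * (M ^ α⁻¹) ^ q) *
      ENNReal.ofReal (Real.exp (b / 2 * (|Y ω| / K) ^ α)) := by
    intro ω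
    rw [← ENNReal.ofReal_mul (by positivity), Real.enorm_eq_ofReal_abs,
      ← ENNReal.ofReal_pow (abs_nonneg _)]
    refine ENNReal.ofReal_le_ofReal ?_
    have hy : 0 ≤ |Y ω| / K := by positivity
    have h1 := rpow_le_mul_exp (u := (|Y ω| / K) ^ α) (r := q / α) (c := b / 2) (by positivity)
      (by positivity) (by positivity)
    rw [← Real.rpow_mul hy, mul_div_cancel₀ _ hα.ne', Real.rpow_natCast] at h1
    have h2 : (q / α / (b / 2)) = M := by rw [hM]; field_simp
    have h3 : M ^ ((q : ℝ) / α) = (M ^ α⁻¹) ^ q := by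
      rw [← Real.rpow_natCast, ← Real.rpow_mul hM0.le]; congr 1; field_simp
    rw [h2, h3] at h1
    calc |Y ω| ^ q = K ^ q * (|Y ω| / K) ^ q := by rw [div_pow]; field_simp
      _ ≤ _ := by rw [mul_assoc]; gcongr
  refine (lintegral_mono hpt).trans ?_
  rw [lintegral_const_mul _ (by fun_prop)]
  refine (mul_le_mul_right (h.lintegral_exp_le ha hb hα hY hK) _).trans ?_
  rw [← ENNReal.ofReal_mul (by positivity)]
  refine ENNReal.ofReal_le_ofReal ?_
  rw [weibullMoment, ← hM, mul_pow, mul_pow]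
  have h4 : 1 + a ≤ (1 + a) ^ q := le_self_pow₀ (by linarith) (by omega)
  have : 0 ≤ K ^ q * (M ^ α⁻¹) ^ q := by positivity
  nlinarith

end SubWeibull

/-! ### Resampling or adding a coordinate preserves product measures. -/

section Concentration

variable {𝒳 𝒴 : Type*} [MeasurableSpace 𝒳] [MeasurableSpace 𝒴]

theorem measurePreserving_update {ι : Type*} [Fintype ι] [DecidableEq ι] (P : Measure 𝒳)
    [IsProbabilityMeasure P] (j : ι) :
    MeasurePreserving (fun w : (ι → 𝒳) × 𝒳 => Function.update w.1 j w.2)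
      ((Measure.pi fun _ : ι => P).prod P) (Measure.pi fun _ : ι => P) := by
  have hm : Measurable fun w : (ι → 𝒳) × 𝒳 => Function.update w.1 j w.2 := by
    refine measurable_pi_lambda _ fun k => ?_
    by_cases hk : k = j
    · subst hk; simpa using measurable_snd
    · simpa [Function.update_of_ne hk] using measurable_fst.eval
  refine ⟨hm, (Measure.pi_eq fun s hs => ?_).symm⟩
  rw [Measure.map_apply hm (MeasurableSet.univ_pi hs)]
  have : (fun w : (ι → 𝒳) × 𝒳 => Function.update w.1 j w.2) ⁻¹' Set.univ.pi s =
      (Set.univ.pi (Function.update s j Set.univ)) ×ˢ s j := by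
    ext w
    simp only [Set.mem_preimage, Set.mem_pi, Set.mem_univ, true_imp_iff, Set.mem_prod]
    constructor
    · intro h
      refine ⟨fun k => ?_, by simpa using h j⟩
      by_cases hk : k = j
      · subst hk; simp
      · simpa [Function.update_of_ne hk] using h k
    · rintro ⟨h1, h2⟩ k
      by_cases hk : k = j
      · subst hk; simpa using h2
      · simpa [Function.update_of_ne hk] using h1 k
  rw [this, Measure.prod_prod, Measure.pi_pi,
    ← Finset.mul_prod_erase Finset.univ _ (Finset.mem_univ j),
    ← Finset.mul_prod_erase Finset.univ (fun i => P (s i)) (Finset.mem_univ j)]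
  rw [Function.update_self, measure_univ, one_mul, mul_comm]
  congr 1
  refine Finset.prod_congr rfl fun k hk => ?_
  rw [Function.update_of_ne (Finset.ne_of_mem_erase hk)]

variable (ν : Measure 𝒴) [IsProbabilityMeasure ν] (P : Measure 𝒳) [IsProbabilityMeasure P]

/-- The new coordinate sits in the last factor of the product, so that the inner integral of
Fubini's theorem averages over it. -/
theorem measurePreserving_cons (m : ℕ) :
    MeasurePreserving (fun w : (Fin m → 𝒳) × 𝒳 => (Fin.cons w.2 w.1 : Fin (m + 1) → 𝒳))
      ((Measure.pi fun _ : Fin m => P).prod P) (Measure.pi fun _ : Fin (m + 1) => P) := by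
  have h1 := (measurePreserving_piFinSuccAbove (fun _ : Fin (m + 1) => P) 0).symm
  have h2 : MeasurePreserving Prod.swap ((Measure.pi fun _ : Fin m => P).prod P)
      (P.prod (Measure.pi fun _ : Fin m => P)) := Measure.measurePreserving_swap
  convert h1.comp h2 using 2 with w
  exact (Fin.insertNth_zero' w.2 w.1).symm

theorem measurePreserving_prod_update {m : ℕ} (j : Fin m) :
    MeasurePreserving
      (fun w : (𝒴 × (Fin m → 𝒳)) × 𝒳 => (w.1.1, Function.update w.1.2 j w.2))
      ((ν.prod (Measure.pi fun _ => P)).prod P) (ν.prod (Measure.pi fun _ => P)) :=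
  ((MeasurePreserving.id ν).prod (measurePreserving_update P j)).comp
    (measurePreserving_prodAssoc ν (Measure.pi fun _ => P) P)

theorem measurePreserving_prod_cons (m : ℕ) :
    MeasurePreserving
      (fun w : (𝒴 × (Fin m → 𝒳)) × 𝒳 => (w.1.1, (Fin.cons w.2 w.1.2 : Fin (m + 1) → 𝒳)))
      ((ν.prod (Measure.pi fun _ => P)).prod P) (ν.prod (Measure.pi fun _ => P)) :=
  ((MeasurePreserving.id ν).prod (measurePreserving_cons P m)).comp
    (measurePreserving_prodAssoc ν (Measure.pi fun _ => P) P)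

end Concentration

/-! ### The Efron–Stein inequality for even moments, with a frozen parameter in `𝒴`. -/

section Concentration

variable {𝒳 𝒴 : Type*} [MeasurableSpace 𝒳] [MeasurableSpace 𝒴]
variable (ν : Measure 𝒴) [IsProbabilityMeasure ν] (P : Measure 𝒳) [IsProbabilityMeasure P]

set_option maxHeartbeats 400000 in
/-- A moment version of the Efron–Stein inequality. -/
theorem eLpNorm_sub_integral_pi_le {k : ℕ} (hk : 1 ≤ k) {b : ℝ} (hb : 0 < b) (m : ℕ)
    (F : 𝒴 × (Fin m → 𝒳) → ℝ)
    (hF : MemLp F ((2 * k : ℕ) : ℝ≥0∞) (ν.prod (Measure.pi fun _ => P)))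
    (h : ∀ j, eLpNorm
      (fun w : (𝒴 × (Fin m → 𝒳)) × 𝒳 => F w.1 - F (w.1.1, Function.update w.1.2 j w.2))
      ((2 * k : ℕ) : ℝ≥0∞) ((ν.prod (Measure.pi fun _ => P)).prod P) ≤ ENNReal.ofReal b) :
    eLpNorm (fun w => F w - ∫ z, F (w.1, z) ∂(Measure.pi fun _ : Fin m => P))
      ((2 * k : ℕ) : ℝ≥0∞) (ν.prod (Measure.pi fun _ => P)) ≤
      ENNReal.ofReal (Real.sqrt (8 * k ^ 2 * (m + 1)) * b) := by
  have h2k : 1 ≤ 2 * k := by omega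
  have h2k' : (1 : ℝ≥0∞) ≤ ((2 * k : ℕ) : ℝ≥0∞) := by exact_mod_cast h2k
  have hk' : (1 : ℝ) ≤ k := by exact_mod_cast hk
  induction m with
  | zero =>
    have : (fun w : 𝒴 × (Fin 0 → 𝒳) =>
        F w - ∫ z, F (w.1, z) ∂(Measure.pi fun _ : Fin 0 => P)) = 0 := by
      ext ⟨y, z⟩
      have : ∀ z' : Fin 0 → 𝒳, F (y, z') = F (y, z) := fun z' => by
        rw [Subsingleton.elim z' z]
      simp [this]
    rw [this]; simp
  -- Coordinate 0 is split off. `G` is the average of `F` over it, `d = F - G` is the new martingale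
  -- difference, and `S`, the centered `G`, is handled by induction.
  | succ m ih =>
    set π := Measure.pi fun _ : Fin m => P
    set π' := Measure.pi fun _ : Fin (m + 1) => P
    set c : (𝒴 × (Fin m → 𝒳)) × 𝒳 → 𝒴 × (Fin (m + 1) → 𝒳) :=
      fun w => (w.1.1, Fin.cons w.2 w.1.2) with hc
    have hcmp : MeasurePreserving c ((ν.prod π).prod P) (ν.prod π') :=
      measurePreserving_prod_cons ν P m
    set F₁ : (𝒴 × (Fin m → 𝒳)) × 𝒳 → ℝ := fun w => F (c w) with hF₁
    have hF₁m : MemLp F₁ ((2 * k : ℕ) : ℝ≥0∞) ((ν.prod π).prod P) :=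
      hF.comp_measurePreserving hcmp
    set G : 𝒴 × (Fin m → 𝒳) → ℝ := fun w => ∫ x, F₁ (w, x) ∂P with hG
    have hGm : MemLp G ((2 * k : ℕ) : ℝ≥0∞) (ν.prod π) := hF₁m.integral_prod_right h2k
    have hF₁i : Integrable F₁ ((ν.prod π).prod P) := hF₁m.integrable h2k'
    have hsec : ∀ᵐ w ∂(ν.prod π), Integrable (fun x => F₁ (w, x)) P := hF₁i.prod_right_ae
    set S : 𝒴 × (Fin m → 𝒳) → ℝ := fun w => G w - ∫ z, G (w.1, z) ∂π with hS
    have hGa : MemLp (fun y => ∫ z, G (y, z) ∂π) ((2 * k : ℕ) : ℝ≥0∞) ν :=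
      hGm.integral_prod_right h2k
    have hSm : MemLp S ((2 * k : ℕ) : ℝ≥0∞) (ν.prod π) :=
      hGm.sub (hGa.comp_measurePreserving measurePreserving_fst)
    -- the induction hypothesis for `G`
    have hSb : eLpNorm S ((2 * k : ℕ) : ℝ≥0∞) (ν.prod π) ≤
        ENNReal.ofReal (Real.sqrt (8 * k ^ 2 * (m + 1)) * b) := by
      -- The differences of `G` are averages of the differences of `F` in coordinate `j + 1`, so
      -- Jensen's inequality carries over the bound.
      refine ih G hGm fun j => ?_
      have hup := measurePreserving_prod_update ν P j
      have hsec2 : ∀ᵐ w ∂((ν.prod π).prod P), Integrable (fun x => F₁ (w.1, x)) P :=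
        measurePreserving_fst.quasiMeasurePreserving.ae hsec
      have hsec3 : ∀ᵐ w ∂((ν.prod π).prod P),
          Integrable (fun x => F₁ ((w.1.1, Function.update w.1.2 j w.2), x)) P :=
        hup.quasiMeasurePreserving.ae hsec
      -- the difference of `F` in the coordinate `j + 1`, the new coordinate integrated last
      set D : ((𝒴 × (Fin m → 𝒳)) × 𝒳) × 𝒳 → ℝ := fun w =>
        F₁ (w.1.1, w.2) - F₁ ((w.1.1.1, Function.update w.1.1.2 j w.1.2), w.2) with hD
      have hmp : MeasurePreserving
          (fun w : ((𝒴 × (Fin m → 𝒳)) × 𝒳) × 𝒳 => (c (w.1.1, w.2), w.1.2))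
          (((ν.prod π).prod P).prod P) ((ν.prod π').prod P) := by
        have e1 := measurePreserving_prodAssoc (ν.prod π) P P
        have e2 := (MeasurePreserving.id (ν.prod π)).prod
          (Measure.measurePreserving_swap (μ := P) (ν := P))
        have e3 := (measurePreserving_prodAssoc (ν.prod π) P P).symm
        exact (hcmp.prod (MeasurePreserving.id P)).comp (e3.comp (e2.comp e1))
      have hDeq : D = (fun w : (𝒴 × (Fin (m + 1) → 𝒳)) × 𝒳 =>
          F w.1 - F (w.1.1, Function.update w.1.2 j.succ w.2)) ∘
          (fun w : ((𝒴 × (Fin m → 𝒳)) × 𝒳) × 𝒳 => (c (w.1.1, w.2), w.1.2)) := by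
        ext w
        simp only [hD, hF₁, hc, Function.comp_apply, Fin.cons_update]
      have hdiffm : AEStronglyMeasurable (fun w : (𝒴 × (Fin (m + 1) → 𝒳)) × 𝒳 =>
          F w.1 - F (w.1.1, Function.update w.1.2 j.succ w.2)) ((ν.prod π').prod P) :=
        (hF.1.comp_measurePreserving measurePreserving_fst).sub
          (hF.1.comp_measurePreserving (measurePreserving_prod_update ν P j.succ))
      have hDm : AEStronglyMeasurable D (((ν.prod π).prod P).prod P) := by
        rw [hDeq]; exact hdiffm.comp_measurePreserving hmp
      have hDb : eLpNorm D ((2 * k : ℕ) : ℝ≥0∞) (((ν.prod π).prod P).prod P) ≤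
          ENNReal.ofReal b := by
        rw [hDeq, eLpNorm_comp_measurePreserving hdiffm hmp]
        exact h j.succ
      refine le_trans (le_of_eq ?_) ((eLpNorm_integral_prod_right_le hDm h2k).trans hDb)
      refine eLpNorm_congr_ae ?_
      filter_upwards [hsec2, hsec3] with w h1 h2
      exact (integral_sub h1 h2).symm
    -- the increment
    set d : (𝒴 × (Fin m → 𝒳)) × 𝒳 → ℝ := fun w => F₁ w - G w.1 with hd
    have hdm : MemLp d ((2 * k : ℕ) : ℝ≥0∞) ((ν.prod π).prod P) :=
      hF₁m.sub (hGm.comp_measurePreserving measurePreserving_fst)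
    have hdb : eLpNorm d ((2 * k : ℕ) : ℝ≥0∞) ((ν.prod π).prod P) ≤ ENNReal.ofReal b := by
      set D : ((𝒴 × (Fin m → 𝒳)) × 𝒳) × 𝒳 → ℝ := fun w => F₁ w.1 - F₁ (w.1.1, w.2) with hD
      have hmp : MeasurePreserving (fun w : ((𝒴 × (Fin m → 𝒳)) × 𝒳) × 𝒳 => (c w.1, w.2))
          (((ν.prod π).prod P).prod P) ((ν.prod π').prod P) :=
        hcmp.prod (MeasurePreserving.id P)
      have hDeq : D = (fun w : (𝒴 × (Fin (m + 1) → 𝒳)) × 𝒳 =>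
          F w.1 - F (w.1.1, Function.update w.1.2 0 w.2)) ∘
          (fun w : ((𝒴 × (Fin m → 𝒳)) × 𝒳) × 𝒳 => (c w.1, w.2)) := by
        ext w
        simp only [hD, hF₁, hc, Function.comp_apply, Fin.update_cons_zero]
      have hdiffm : AEStronglyMeasurable (fun w : (𝒴 × (Fin (m + 1) → 𝒳)) × 𝒳 =>
          F w.1 - F (w.1.1, Function.update w.1.2 0 w.2)) ((ν.prod π').prod P) :=
        (hF.1.comp_measurePreserving measurePreserving_fst).sub
          (hF.1.comp_measurePreserving (measurePreserving_prod_update ν P 0))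
      have hDm : AEStronglyMeasurable D (((ν.prod π).prod P).prod P) := by
        rw [hDeq]; exact hdiffm.comp_measurePreserving hmp
      have hDb : eLpNorm D ((2 * k : ℕ) : ℝ≥0∞) (((ν.prod π).prod P).prod P) ≤
          ENNReal.ofReal b := by
        rw [hDeq, eLpNorm_comp_measurePreserving hdiffm hmp]
        exact h 0
      refine le_trans (le_of_eq ?_) ((eLpNorm_integral_prod_right_le hDm h2k).trans hDb)
      refine eLpNorm_congr_ae ?_
      have hsec2 : ∀ᵐ w ∂((ν.prod π).prod P), Integrable (fun x => F₁ (w.1, x)) P :=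
        measurePreserving_fst.quasiMeasurePreserving.ae hsec
      filter_upwards [hsec2] with w h1
      simp only [hD, hd, hG]
      rw [integral_sub (integrable_const _) h1]
      simp
    have hS₁m : MemLp (fun w : (𝒴 × (Fin m → 𝒳)) × 𝒳 => S w.1) ((2 * k : ℕ) : ℝ≥0∞)
        ((ν.prod π).prod P) := hSm.comp_measurePreserving measurePreserving_fst
    have hS₁b : eLpNorm (fun w : (𝒴 × (Fin m → 𝒳)) × 𝒳 => S w.1) ((2 * k : ℕ) : ℝ≥0∞)
        ((ν.prod π).prod P) ≤ ENNReal.ofReal (Real.sqrt (8 * k ^ 2 * (m + 1)) * b) := by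
      change eLpNorm (S ∘ Prod.fst) _ _ ≤ _
      rw [eLpNorm_comp_measurePreserving hSm.1 measurePreserving_fst]
      exact hSb
    have hSd := hS₁m.integrable_pow_sub_one_mul hk hdm
    -- `S` does not depend on the new coordinate, over which `d` has mean zero.
    have hzero : ∫ w, S w.1 ^ (2 * k - 1) * d w ∂((ν.prod π).prod P) = 0 := by
      rw [integral_prod _ hSd]
      refine integral_eq_zero_of_ae ?_
      filter_upwards [hsec] with w h1
      simp only [hd, Pi.zero_apply]
      rw [integral_const_mul, integral_sub h1 (integrable_const _)]
      simp [hG]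
    have hA0 : 0 ≤ Real.sqrt (8 * k ^ 2 * (m + 1)) * b := by positivity
    -- The extra `+ 1` under the root serves here: it makes the step condition hold even at `m = 0`,
    -- where `S` vanishes.
    have hbA : 2 * k * b ≤ Real.sqrt (8 * k ^ 2 * (m + 1)) * b := by
      gcongr
      apply Real.le_sqrt_of_sq_le
      have : (0 : ℝ) ≤ m := by positivity
      nlinarith [sq_nonneg (k : ℝ), mul_nonneg (sq_nonneg (k : ℝ)) this]
    have hstep := integral_add_pow_even_le hk hb hbA hS₁m hdm
      ((eLpNorm_even_le_iff hk hS₁m hA0).1 hS₁b) ((eLpNorm_even_le_iff hk hdm hb.le).1 hdb) hSd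
      hzero
    have htot : eLpNorm (fun w => S w.1 + d w) ((2 * k : ℕ) : ℝ≥0∞) ((ν.prod π).prod P) ≤
        ENNReal.ofReal (Real.sqrt (8 * k ^ 2 * ((m + 1 : ℕ) + 1)) * b) := by
      refine (eLpNorm_even_le_iff hk (hS₁m.add hdm) (by positivity)).2 ?_
      refine hstep.trans ?_
      rw [pow_mul (_ * b)]
      refine pow_le_pow_left₀ (by positivity) ?_ k
      rw [mul_pow, mul_pow, Real.sq_sqrt (by positivity), Real.sq_sqrt (by positivity)]
      push_cast
      have : (k : ℝ) * b ^ 2 ≤ k ^ 2 * b ^ 2 := by gcongr; nlinarith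
      nlinarith
    have hm0 : AEStronglyMeasurable (fun w => F w - ∫ z, F (w.1, z) ∂π') (ν.prod π') :=
      hF.1.sub ((hF.integral_prod_right h2k).1.comp_measurePreserving measurePreserving_fst)
    rw [← eLpNorm_comp_measurePreserving hm0 hcmp]
    refine le_trans (le_of_eq (eLpNorm_congr_ae ?_)) htot
    -- Fubini requires the section of `F` at `y` to be integrable, which is known only for almost
    -- every `y`.
    have hint : ∀ᵐ y ∂ν, ∫ z, F (y, z) ∂π' = ∫ z, G (y, z) ∂π := by
      filter_upwards [(hF.integrable h2k').prod_right_ae] with y hy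
      have hcons : MeasurePreserving _ (π.prod P) π' := measurePreserving_cons P m
      rw [← hcons.map_eq, integral_map hcons.measurable.aemeasurable
        (by rw [hcons.map_eq]; exact hy.1), integral_prod]
      exact hcons.integrable_comp_of_integrable hy
    have hint' : ∀ᵐ w ∂((ν.prod π).prod P), ∫ z, F (w.1.1, z) ∂π' = ∫ z, G (w.1.1, z) ∂π :=
      (measurePreserving_fst.comp measurePreserving_fst).quasiMeasurePreserving.ae hint
    filter_upwards [hint'] with w hw
    simp only [hS, hd, hF₁, Function.comp_apply]
    rw [show (c w).1 = w.1.1 from rfl, hw]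
    ring

end Concentration

/-! ### Combinatorics of the folds and the decomposition of `∇ᵢ R̂_cv`. -/

section Folds

variable {n V : ℕ}

theorem div_pos_of_dvd_of_fin (hV : V ∣ n) (i : Fin n) : 0 < n / V :=
  Nat.div_pos (Nat.le_of_dvd i.pos hV) (Nat.pos_of_dvd_of_pos hV i.pos)

theorem foldOf_lt (hV : V ∣ n) (i : Fin n) : foldOf V i < V := by
  rw [foldOf, Nat.div_lt_iff_lt_mul (div_pos_of_dvd_of_fin hV i), Nat.mul_div_cancel' hV]
  exact i.isLt

theorem trainIdx_injective (n V v : ℕ) : Function.Injective (trainIdx n V v) := by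
  intro k l h
  have h' := congrArg Fin.val h
  have hs := Nat.zero_le (n / V)
  unfold trainIdx at h'
  ext
  split_ifs at h' <;> simp at h' <;> omega

theorem foldOf_trainIdx_ne (hV : V ∣ n) (v : ℕ) (k : Fin (trainSize n V)) :
    foldOf V (trainIdx n V v k) ≠ v := by
  have hs := div_pos_of_dvd_of_fin hV (trainIdx n V v k)
  unfold trainIdx foldOf
  split_ifs with h
  · exact ((Nat.div_lt_iff_lt_mul hs).2 h).ne
  · rw [Nat.add_div_right _ hs]
    have := (Nat.le_div_iff_mul_le hs).2 (not_lt.1 h)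
    omega

theorem exists_trainIdx_eq (hV : V ∣ n) {v : ℕ} (hv : v < V) {j : Fin n} (hj : foldOf V j ≠ v) :
    ∃ k, trainIdx n V v k = j := by
  have hs := div_pos_of_dvd_of_fin hV j
  have hn : n = V * (n / V) := (Nat.mul_div_cancel' hV).symm
  unfold foldOf at hj
  have hjn := j.isLt
  rcases lt_or_gt_of_ne hj with h | h
  · have h1 : j.val < v * (n / V) := (Nat.div_lt_iff_lt_mul hs).1 h
    have h2 : (v + 1) * (n / V) ≤ V * (n / V) := Nat.mul_le_mul_right _ hv
    rw [add_mul, one_mul] at h2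
    refine ⟨⟨j.val, by unfold trainSize; omega⟩, ?_⟩
    unfold trainIdx
    rw [if_pos h1]
  · have h1 : (v + 1) * (n / V) ≤ j.val := (Nat.le_div_iff_mul_le hs).1 h
    rw [add_mul, one_mul] at h1
    refine ⟨⟨j.val - n / V, by unfold trainSize; omega⟩, ?_⟩
    unfold trainIdx
    rw [if_neg (by simp; omega)]
    ext
    simp; omega

theorem trainIdx_ne_of_foldOf_eq (hV : V ∣ n) {v : ℕ} {i : Fin n} (hi : foldOf V i = v)
    (k : Fin (trainSize n V)) : trainIdx n V v k ≠ i := fun h =>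
  foldOf_trainIdx_ne hV v k (h ▸ hi)

theorem card_filter_foldOf_ne (hV : V ∣ n) {v : ℕ} (hv : v < V) :
    (Finset.univ.filter fun j : Fin n => foldOf V j ≠ v).card = trainSize n V := by
  have : (Finset.univ.filter fun j : Fin n => foldOf V j ≠ v) =
      Finset.univ.image (trainIdx n V v) := by
    ext j
    simp only [Finset.mem_filter, Finset.mem_univ, true_and, Finset.mem_image]
    exact ⟨fun h => exists_trainIdx_eq hV hv h, fun ⟨k, hk⟩ => hk ▸ foldOf_trainIdx_ne hV v k⟩
  rw [this, Finset.card_image_of_injective _ (trainIdx_injective n V v), Finset.card_univ,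
    Fintype.card_fin]

variable {𝒳 : Type*}

theorem dropFold_update_of_foldOf_eq (hV : V ∣ n) {v : ℕ} {i : Fin n} (hi : foldOf V i = v)
    (x : Fin n → 𝒳) (y : 𝒳) : dropFold V v (Function.update x i y) = dropFold V v x := by
  ext k
  exact Function.update_of_ne (trainIdx_ne_of_foldOf_eq hV hi k) _ _

theorem dropFold_update_trainIdx (v : ℕ) (k : Fin (trainSize n V)) (x : Fin n → 𝒳) (y : 𝒳) :
    dropFold V v (Function.update x (trainIdx n V v k) y) =
      Function.update (dropFold V v x) k y := by
  ext l
  by_cases h : l = k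
  · subst h; simp [dropFold]
  · simp [dropFold, Function.update_of_ne h,
      Function.update_of_ne ((trainIdx_injective n V v).ne h)]

/-- The part of `n (R̂_cv(z^{y₁}) - R̂_cv(z^{y₂}))`, where `z^y` is `z` with its `i`-th entry
replaced by `y`, that comes from the losses trained on the `i`-th sample point. -/
noncomputable def crossTerm (V : ℕ) (L : 𝒳 → (Fin (trainSize n V) → 𝒳) → ℝ) (i : Fin n)
    (y₁ y₂ : 𝒳) (z : Fin n → 𝒳) : ℝ :=
  ∑ j with foldOf V j ≠ foldOf V i,
    (L (z j) (dropFold V (foldOf V j) (Function.update z i y₁)) -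
      L (z j) (dropFold V (foldOf V j) (Function.update z i y₂)))

/-- Entry `i` of `z` is overwritten inside the training samples and is never a test point. Hence
`X_i` may be replaced there by a fresh variable, which makes the vector independent of `(X_i,
X'_i)`. -/
theorem crossTerm_update_self (L : 𝒳 → (Fin (trainSize n V) → 𝒳) → ℝ) (i : Fin n)
    (y₁ y₂ y : 𝒳) (z : Fin n → 𝒳) :
    crossTerm V L i y₁ y₂ (Function.update z i y) = crossTerm V L i y₁ y₂ z := by
  unfold crossTerm
  refine Finset.sum_congr rfl fun j hj => ?_
  have hji : j ≠ i := by
    rintro rfl; simp at hj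
  simp [Function.update_of_ne hji]

/-- Models tested on the fold of `i` are not trained on `i`, so within that fold only the summand `j
= i` changes. Outside it, `i` is a training point for every summand, which gives `crossTerm`. -/
theorem mul_nabla_cvRisk (hV : V ∣ n) (L : 𝒳 → (Fin (trainSize n V) → 𝒳) → ℝ) (i : Fin n)
    (x x' : Fin n → 𝒳) :
    n * nabla x' i (cvRisk V L) x =
      L (x i) (dropFold V (foldOf V i) x) - L (x' i) (dropFold V (foldOf V i) x)
        + crossTerm V L i (x i) (x' i) x := by
  have hn : (n : ℝ) ≠ 0 := by exact_mod_cast i.pos.ne'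
  unfold nabla cvRisk
  rw [mul_sub, mul_inv_cancel_left₀ hn, mul_inv_cancel_left₀ hn, ← Finset.sum_sub_distrib,
    ← Finset.sum_filter_add_sum_filter_not _ (fun j : Fin n => foldOf V j ≠ foldOf V i),
    add_comm]
  congr 1
  · rw [Finset.sum_eq_single i]
    · rw [dropFold_update_of_foldOf_eq hV rfl, Function.update_self]
    · intro j hj hji
      have hj' : foldOf V j = foldOf V i := by simpa using hj
      rw [dropFold_update_of_foldOf_eq hV hj'.symm, Function.update_of_ne hji, sub_self]
    · intro h; simp at h
  · unfold crossTerm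
    refine Finset.sum_congr rfl fun j hj => ?_
    have hji : j ≠ i := by
      rintro rfl; simp at hj
    rw [Function.update_of_ne hji, Function.update_eq_self]

end Folds

/-! ### Joint laws of disjoint blocks of an i.i.d. family. -/

section IID

variable {Ω 𝒳 ι κ κ' : Type*} [MeasurableSpace Ω] [MeasurableSpace 𝒳]

/-- The `U i` are independent with common law `P`. -/
structure IsIID (μ : Measure Ω) (P : Measure 𝒳) (U : ι → Ω → 𝒳) : Prop where
  measurable : ∀ i, Measurable (U i)
  law : ∀ i, μ.map (U i) = P
  indep : iIndepFun U μ

theorem IsIIDSample.isIID {n : ℕ} {μ : Measure Ω} {P : Measure 𝒳} {X₀ : Ω → 𝒳}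
    {X X' : Fin n → Ω → 𝒳} (h : IsIIDSample μ P X₀ X X') :
    IsIID μ P (fun k : Option (Fin n ⊕ Fin n) => k.elim X₀ (Sum.elim X X')) where
  measurable := by
    rintro (_ | i | i)
    exacts [h.measurable_zero, h.measurable_data i, h.measurable_copy i]
  law := by
    rintro (_ | i | i)
    exacts [h.law_zero, h.law_data i, h.law_copy i]
  indep := h.indep

namespace IsIID

variable {μ : Measure Ω} {P : Measure 𝒳} {U : ι → Ω → 𝒳} (h : IsIID μ P U)
include h

theorem measurePreserving_apply (i : ι) : MeasurePreserving (U i) μ P := ⟨h.measurable i, h.law i⟩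

theorem indepFun_comp [Fintype κ] [Fintype κ'] {e : κ → ι} {e' : κ' → ι}
    (hd : ∀ k k', e k ≠ e' k') :
    IndepFun (fun ω k => U (e k) ω) (fun ω k => U (e' k) ω) μ := by
  classical
  have h1 := h.indep.indepFun_finset (Finset.univ.image e) (Finset.univ.image e')
    (by
      rw [Finset.disjoint_left]
      intro a ha hb
      obtain ⟨k, -, rfl⟩ := Finset.mem_image.1 ha
      obtain ⟨k', -, hk⟩ := Finset.mem_image.1 hb
      exact hd k k' hk.symm) h.measurable
  exact h1.comp
    (φ := fun (w : (Finset.univ.image e) → 𝒳) (k : κ) =>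
      w ⟨e k, Finset.mem_image_of_mem e (Finset.mem_univ k)⟩)
    (ψ := fun (w : (Finset.univ.image e') → 𝒳) (k : κ') =>
      w ⟨e' k, Finset.mem_image_of_mem e' (Finset.mem_univ k)⟩)
    (measurable_pi_lambda _ fun k => measurable_pi_apply _)
    (measurable_pi_lambda _ fun k => measurable_pi_apply _)

variable [IsProbabilityMeasure μ]

theorem measurePreserving_comp [Fintype κ] {e : κ → ι} (he : Function.Injective e) :
    MeasurePreserving (fun ω k => U (e k) ω) μ (Measure.pi fun _ : κ => P) := by
  refine ⟨measurable_pi_lambda _ fun k => h.measurable _, ?_⟩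
  have h1 := (iIndepFun_iff_map_fun_eq_pi_map
    (fun k => (h.measurable (e k)).aemeasurable)).1 (h.indep.precomp he)
  rw [h1]
  simp only [h.law]

theorem measurePreserving_prod [Fintype κ] [Fintype κ'] {e : κ → ι} {e' : κ' → ι}
    (hd : ∀ k k', e k ≠ e' k') {β γ : Type*} [MeasurableSpace β] [MeasurableSpace γ]
    {φ : (κ → 𝒳) → β} {ψ : (κ' → 𝒳) → γ} (hφ : Measurable φ) (hψ : Measurable ψ)
    {ρ : Measure β} {σ : Measure γ}
    (h1 : MeasurePreserving (fun ω => φ fun k => U (e k) ω) μ ρ)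
    (h2 : MeasurePreserving (fun ω => ψ fun k => U (e' k) ω) μ σ) :
    MeasurePreserving (fun ω => (φ fun k => U (e k) ω, ψ fun k => U (e' k) ω)) μ (ρ.prod σ) := by
  have hi : IndepFun (fun ω => φ fun k => U (e k) ω) (fun ω => ψ fun k => U (e' k) ω) μ :=
    (h.indepFun_comp hd).comp hφ hψ
  refine ⟨h1.measurable.prodMk h2.measurable, ?_⟩
  rw [(indepFun_iff_map_prod_eq_prod_map_map h1.aemeasurable h2.aemeasurable).1 hi,
    h1.map_eq, h2.map_eq]

theorem measurePreserving_pair [Fintype κ] {t : ι} {e : κ → ι} (he : Function.Injective e)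
    (ht : ∀ k, e k ≠ t) :
    MeasurePreserving (fun ω => (U t ω, fun k => U (e k) ω)) μ
      (P.prod (Measure.pi fun _ : κ => P)) :=
  h.measurePreserving_prod (e := fun _ : Unit => t) (e' := e) (φ := fun w => w ()) (ψ := id)
    (fun _ k => (ht k).symm) (measurable_pi_apply _) measurable_id
    (h.measurePreserving_apply t) (h.measurePreserving_comp he)

theorem measurePreserving_triple [Fintype κ] {t t₁ : ι} {e : κ → ι} (he : Function.Injective e)
    (ht : ∀ k, e k ≠ t) (ht₁ : ∀ k, e k ≠ t₁) (htt : t ≠ t₁) :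
    MeasurePreserving (fun ω => ((U t ω, fun k => U (e k) ω), U t₁ ω)) μ
      ((P.prod (Measure.pi fun _ : κ => P)).prod P) :=
  h.measurePreserving_prod (e := fun o : Option κ => o.elim t e) (e' := fun _ : Unit => t₁)
    (φ := fun w => (w none, fun k => w (some k))) (ψ := fun w => w ())
    (by rintro (_ | k) _; exacts [htt, ht₁ k]) (by fun_prop) (by fun_prop)
    (h.measurePreserving_pair he ht) (h.measurePreserving_apply t₁)

theorem measurePreserving_quadruple [Fintype κ] {t t₁ t₂ : ι} {e : κ → ι}
    (he : Function.Injective e) (ht : ∀ k, e k ≠ t) (ht₁ : ∀ k, e k ≠ t₁) (ht₂ : ∀ k, e k ≠ t₂)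
    (h01 : t ≠ t₁) (h02 : t ≠ t₂) (h12 : t₁ ≠ t₂) :
    MeasurePreserving (fun ω => (((U t ω, fun k => U (e k) ω), U t₁ ω), U t₂ ω)) μ
      (((P.prod (Measure.pi fun _ : κ => P)).prod P).prod P) :=
  h.measurePreserving_prod (e := fun o : Option (Option κ) => o.elim t₁ fun o => o.elim t e)
    (e' := fun _ : Unit => t₂)
    (φ := fun w => ((w (some none), fun k => w (some (some k))), w none)) (ψ := fun w => w ())
    (by rintro (_ | _ | k) _; exacts [h12, h02, ht₂ k]) (by fun_prop) (by fun_prop)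
    (h.measurePreserving_triple he ht ht₁ h01) (h.measurePreserving_apply t₂)

end IsIID

end IID

/-! ### Stability as norm bounds under product measures. -/

section StableNorms

variable {𝒳 : Type*} [MeasurableSpace 𝒳] {N : ℕ}

/-- Bounds on the `q`-norms of a loss and of its differences, and of the differences of its risk,
with respect to i.i.d. samples. -/
structure StableNorms (P : Measure 𝒳) (L : 𝒳 → (Fin N → 𝒳) → ℝ) (q : ℕ) (B₀ B₁ B₂ BR : ℝ) :
    Prop where
  measurable : Measurable (Function.uncurry L)
  symmetric : ∀ x₀ z (σ : Equiv.Perm (Fin N)), L x₀ (z ∘ σ) = L x₀ z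
  norm_loss : eLpNorm (fun w : 𝒳 × (Fin N → 𝒳) => L w.1 w.2) q
    (P.prod (Measure.pi fun _ => P)) ≤ ENNReal.ofReal B₀
  norm_diff : ∀ k, eLpNorm (fun w : (𝒳 × (Fin N → 𝒳)) × 𝒳 =>
      L w.1.1 w.1.2 - L w.1.1 (Function.update w.1.2 k w.2)) q
    ((P.prod (Measure.pi fun _ => P)).prod P) ≤ ENNReal.ofReal B₁
  norm_diff_diff : ∀ k l, k ≠ l → eLpNorm (fun w : ((𝒳 × (Fin N → 𝒳)) × 𝒳) × 𝒳 =>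
      (L w.1.1.1 w.1.1.2 - L w.1.1.1 (Function.update w.1.1.2 k w.1.2)) -
      (L w.1.1.1 (Function.update w.1.1.2 l w.2) -
        L w.1.1.1 (Function.update (Function.update w.1.1.2 l w.2) k w.1.2))) q
    (((P.prod (Measure.pi fun _ => P)).prod P).prod P) ≤ ENNReal.ofReal B₂
  norm_risk_diff : ∀ k, eLpNorm (fun w : 𝒳 × (Fin N → 𝒳) =>
      risk P L w.2 - risk P L (Function.update w.2 k w.1)) q
    (P.prod (Measure.pi fun _ => P)) ≤ ENNReal.ofReal BR

theorem Measurable.loss_comp {β : Type*} [MeasurableSpace β] {L : 𝒳 → (Fin N → 𝒳) → ℝ}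
    (hL : Measurable (Function.uncurry L)) {f : β → 𝒳} {g : β → Fin N → 𝒳}
    (hf : Measurable f) (hg : Measurable g) : Measurable fun w => L (f w) (g w) :=
  hL.comp (hf.prodMk hg)

theorem Measurable.function_update {β ι : Type*} [DecidableEq ι] [MeasurableSpace β]
    {f : β → ι → 𝒳} {g : β → 𝒳} (hf : Measurable f) (hg : Measurable g) (k : ι) :
    Measurable fun w => Function.update (f w) k (g w) := by
  refine measurable_pi_lambda _ fun j => ?_
  by_cases hj : j = k
  · subst hj; simpa using hg
  · simpa [Function.update_of_ne hj] using hf.eval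

theorem measurable_risk {P : Measure 𝒳} [SFinite P] {L : 𝒳 → (Fin N → 𝒳) → ℝ}
    (hL : Measurable (Function.uncurry L)) : Measurable (risk P L) :=
  (hL.stronglyMeasurable.integral_prod_left (μ := P)).measurable

theorem StableNorms.memLp_loss {P : Measure 𝒳} {L : 𝒳 → (Fin N → 𝒳) → ℝ} {q : ℕ}
    {B₀ B₁ B₂ BR : ℝ} (h : StableNorms P L q B₀ B₁ B₂ BR) :
    MemLp (fun w : 𝒳 × (Fin N → 𝒳) => L w.1 w.2) q (P.prod (Measure.pi fun _ => P)) :=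
  ⟨h.measurable.aestronglyMeasurable, h.norm_loss.trans_lt ENNReal.ofReal_lt_top⟩

theorem risk_comp_perm {P : Measure 𝒳} {L : 𝒳 → (Fin N → 𝒳) → ℝ}
    (hs : ∀ x₀ z (σ : Equiv.Perm (Fin N)), L x₀ (z ∘ σ) = L x₀ z)
    (z : Fin N → 𝒳) (σ : Equiv.Perm (Fin N)) : risk P L (z ∘ σ) = risk P L z := by
  simp only [risk, hs]

end StableNorms

/-- The assumptions concern one configuration: test point `X₀`, fold 0 removed. As they depend only
on the law, they pass to product measures and thence to any other choice of distinct indices. -/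
theorem IsStableLoss.stableNorms {Ω 𝒳 : Type*} [MeasurableSpace Ω] [MeasurableSpace 𝒳] {n p V : ℕ}
    {μ : Measure Ω} [IsProbabilityMeasure μ] {P : Measure 𝒳} [IsProbabilityMeasure P]
    {X₀ : Ω → 𝒳} {X X' : Fin n → Ω → 𝒳} {L : Fin p → 𝒳 → (Fin (trainSize n V) → 𝒳) → ℝ}
    {a b α εl εR : ℝ} (hX : IsIIDSample μ P X₀ X X') (h : IsStableLoss V μ P X₀ X X' L a b α εl εR)
    (ha : 0 < a) (hb : 0 < b) (hα : 0 < α) (hn : 0 < n) (hl : 0 < εl) (hR : 0 < εR)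
    {q : ℕ} (hq : 1 ≤ q) (r : Fin p) :
    StableNorms P (L r) q (weibullMoment a b α q)
      ((n : ℝ) ^ (-(1 / 2) : ℝ) * εl * weibullMoment a b α q)
      ((n : ℝ) ^ (-(3 / 2) : ℝ) * εl * weibullMoment a b α q)
      ((n : ℝ)⁻¹ * εR * weibullMoment a b α q) := by
  have hn' : (0 : ℝ) < n := by exact_mod_cast hn
  have hU := hX.isIID
  have hLm := h.measurable_loss r
  have hinj : Function.Injective fun k => (some (Sum.inl (trainIdx n V 0 k)) :
      Option (Fin n ⊕ Fin n)) :=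
    (Option.some_injective _).comp (Sum.inl_injective.comp (trainIdx_injective n V 0))
  refine ⟨hLm, h.symmetric r, ?_, fun k => ?_, ?_, fun k => ?_⟩
  · have hmp := hU.measurePreserving_pair (t := none) hinj (by simp)
    have hg : Measurable fun w : 𝒳 × (Fin (trainSize n V) → 𝒳) => L r w.1 w.2 := hLm
    rw [← eLpNorm_comp_measurePreserving hg.aestronglyMeasurable hmp]
    have := (h.loss_tail r).eLpNorm_le ha hb hα (hg.comp hmp.measurable) one_pos hq
    rwa [one_mul] at this
  · have hmp := hU.measurePreserving_triple (t := none)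
      (t₁ := some (Sum.inr (trainIdx n V 0 k))) hinj (by simp) (by simp) (by simp)
    have hg : Measurable (fun w : (𝒳 × (Fin (trainSize n V) → 𝒳)) × 𝒳 =>
        L r w.1.1 w.1.2 - L r w.1.1 (Function.update w.1.2 k w.2)) :=
      (hLm.loss_comp (by fun_prop) (by fun_prop)).sub
        (hLm.loss_comp (by fun_prop) (Measurable.function_update (by fun_prop) (by fun_prop) k))
    rw [← eLpNorm_comp_measurePreserving hg.aestronglyMeasurable hmp]
    exact (h.loss_first_order r k).eLpNorm_le ha hb hα (hg.comp hmp.measurable) (by positivity) hq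
  · intro k l hkl
    have hmp := hU.measurePreserving_quadruple (t := none)
        (t₁ := some (Sum.inr (trainIdx n V 0 k))) (t₂ := some (Sum.inr (trainIdx n V 0 l))) hinj
        (by simp) (by simp) (by simp) (by simp) (by simp)
        (by simpa using (trainIdx_injective n V 0).ne hkl)
    have hg : Measurable (fun w : ((𝒳 × (Fin (trainSize n V) → 𝒳)) × 𝒳) × 𝒳 =>
        (L r w.1.1.1 w.1.1.2 - L r w.1.1.1 (Function.update w.1.1.2 k w.1.2)) -
        (L r w.1.1.1 (Function.update w.1.1.2 l w.2) -
          L r w.1.1.1 (Function.update (Function.update w.1.1.2 l w.2) k w.1.2))) := by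
      refine ((hLm.loss_comp (by fun_prop) (by fun_prop)).sub
        (hLm.loss_comp (by fun_prop) ?_)).sub
        ((hLm.loss_comp (by fun_prop) ?_).sub (hLm.loss_comp (by fun_prop) ?_))
      · exact Measurable.function_update (by fun_prop) (by fun_prop) k
      · exact Measurable.function_update (by fun_prop) (by fun_prop) l
      · exact Measurable.function_update
          (Measurable.function_update (by fun_prop) (by fun_prop) l) (by fun_prop) k
    rw [← eLpNorm_comp_measurePreserving hg.aestronglyMeasurable hmp]
    have hgm := hg.comp hmp.measurable
    rcases lt_or_gt_of_ne hkl with hlt | hlt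
    · exact (h.loss_second_order r k l hlt).eLpNorm_le ha hb hα hgm (by positivity) hq
    -- Second order stability is assumed only for increasing pairs. The mixed difference is
    -- symmetric, because updates at distinct coordinates commute.
    · have e : ((fun w : ((𝒳 × (Fin (trainSize n V) → 𝒳)) × 𝒳) × 𝒳 =>
          (L r w.1.1.1 w.1.1.2 - L r w.1.1.1 (Function.update w.1.1.2 k w.1.2)) -
          (L r w.1.1.1 (Function.update w.1.1.2 l w.2) -
            L r w.1.1.1 (Function.update (Function.update w.1.1.2 l w.2) k w.1.2))) ∘
          fun ω => (((X₀ ω, fun j => X (trainIdx n V 0 j) ω), X' (trainIdx n V 0 k) ω),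
            X' (trainIdx n V 0 l) ω)) = fun ω =>
          nabla (dropFold V 0 fun j => X' j ω) k (nabla (dropFold V 0 fun j => X' j ω) l
            (L r (X₀ ω))) (dropFold V 0 fun j => X j ω) := by
        ext ω
        unfold nabla dropFold
        simp only [Function.comp_apply, Function.update_comm hkl]
        ring
      have h2 := (h.loss_second_order r l k hlt).eLpNorm_le ha hb hα (e ▸ hgm) (by positivity) hq
      rw [← e] at h2
      exact h2
  · have hmp := hU.measurePreserving_pair (t := some (Sum.inr (trainIdx n V 0 k))) hinj (by simp)
    have hRm : Measurable (risk P (L r)) := measurable_risk hLm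
    have hg : Measurable fun w : 𝒳 × (Fin (trainSize n V) → 𝒳) =>
        risk P (L r) w.2 - risk P (L r) (Function.update w.2 k w.1) :=
      (hRm.comp measurable_snd).sub
        (hRm.comp (Measurable.function_update measurable_snd measurable_fst k))
    rw [← eLpNorm_comp_measurePreserving hg.aestronglyMeasurable hmp]
    exact (h.risk_first_order r k).eLpNorm_le ha hb hα (hg.comp hmp.measurable) (by positivity) hq

/-! ### Averaged losses and risks. -/

section Averages

variable {𝒳 : Type*} [MeasurableSpace 𝒳] {N : ℕ} {P : Measure 𝒳} [IsProbabilityMeasure P]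
  {L : 𝒳 → (Fin N → 𝒳) → ℝ}

theorem isIID_eval {ι : Type*} [Fintype ι] (P : Measure 𝒳) [IsProbabilityMeasure P] :
    IsIID (Measure.pi fun _ : ι => P) P (fun i w => w i) where
  measurable i := measurable_pi_apply i
  law i := (measurePreserving_eval (fun _ : ι => P) i).map_eq
  indep := iIndepFun_pi (μ := fun _ : ι => P) (X := fun _ => id) fun _ => aemeasurable_id

/-- The definition places `x` at position 0. A transposition moves it to position `k`, preserving
both the product measure and the symmetric risk. -/
theorem avgRisk_eq (hL : Measurable (Function.uncurry L))
    (hs : ∀ x₀ z (σ : Equiv.Perm (Fin N)), L x₀ (z ∘ σ) = L x₀ z) (k : Fin N) (x : 𝒳) :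
    _root_.avgRisk P L x =
      ∫ z, risk P L (Function.update z k x) ∂(Measure.pi fun _ : Fin N => P) := by
  set k₀ : Fin N := ⟨0, k.pos⟩
  set σ : Equiv.Perm (Fin N) := Equiv.swap k₀ k
  have hmp := (isIID_eval (ι := Fin N) P).measurePreserving_comp σ.injective
  have hm : Measurable fun z : Fin N → 𝒳 => risk P L (Function.update z k x) :=
    (measurable_risk hL).comp (Measurable.function_update measurable_id measurable_const k)
  conv_rhs => rw [← hmp.map_eq]
  rw [integral_map hmp.aemeasurable hm.aestronglyMeasurable, _root_.avgRisk]
  congr 1 with z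
  rw [← risk_comp_perm hs _ σ]
  congr 1
  ext j
  have h1 : ((σ j).val = 0) ↔ j = k := by
    rw [show (σ j).val = 0 ↔ σ j = k₀ from ⟨fun h => Fin.ext h, fun h => congrArg Fin.val h⟩,
      ← Equiv.eq_symm_apply]
    simp [σ]
  by_cases hj : j = k
  · have := h1.2 hj
    subst hj; simp [this]
  · have h2 : ¬ (σ j).val = 0 := fun h => hj (h1.1 h)
    simp [Function.update_of_ne hj, h2]

theorem measurable_avgRisk (hL : Measurable (Function.uncurry L)) :
    Measurable (_root_.avgRisk P L) := by
  have : Measurable fun w : 𝒳 × (Fin N → 𝒳) =>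
      risk P L (fun k => if k.val = 0 then w.1 else w.2 k) := by
    refine (measurable_risk hL).comp (measurable_pi_lambda _ fun k => ?_)
    split_ifs <;> fun_prop
  exact (this.stronglyMeasurable.integral_prod_right
    (ν := Measure.pi fun _ : Fin N => P)).measurable

theorem measurable_avgLoss (hL : Measurable (Function.uncurry L)) : Measurable (avgLoss P L) :=
  (hL.stronglyMeasurable.integral_prod_right (ν := Measure.pi fun _ : Fin N => P)).measurable

theorem measurable_influence (hL : Measurable (Function.uncurry L)) :
    Measurable (influence P L) :=
  (measurable_avgLoss hL).add ((measurable_avgRisk hL).const_mul _)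

namespace StableNorms

variable {q : ℕ} {B₀ B₁ B₂ BR : ℝ} (h : StableNorms P L q B₀ B₁ B₂ BR)
include h

theorem eLpNorm_avgLoss_le (hq : 1 ≤ q) : eLpNorm (avgLoss P L) q P ≤ ENNReal.ofReal B₀ :=
  (eLpNorm_integral_prod_right_le h.memLp_loss.1 hq).trans h.norm_loss

theorem memLp_avgLoss (hq : 1 ≤ q) : MemLp (avgLoss P L) q P :=
  h.memLp_loss.integral_prod_right hq

theorem memLp_risk (hq : 1 ≤ q) : MemLp (risk P L) q (Measure.pi fun _ => P) :=
  (h.memLp_loss.comp_measurePreserving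
    (Measure.measurePreserving_swap (μ := Measure.pi fun _ => P) (ν := P))).integral_prod_right hq

theorem memLp_risk_update (hq : 1 ≤ q) (k : Fin N) :
    MemLp (fun w : 𝒳 × (Fin N → 𝒳) => risk P L (Function.update w.2 k w.1)) q
      (P.prod (Measure.pi fun _ => P)) :=
  (h.memLp_risk hq).comp_measurePreserving ((measurePreserving_update P k).comp
    (Measure.measurePreserving_swap (μ := P) (ν := Measure.pi fun _ => P)))

theorem memLp_avgRisk (hq : 1 ≤ q) : MemLp (_root_.avgRisk P L) q P := by
  rcases N.eq_zero_or_pos with rfl | hN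
  · have : _root_.avgRisk P L = fun _ => ∫ z, risk P L z ∂(Measure.pi fun _ : Fin 0 => P) := by
      ext x
      unfold _root_.avgRisk
      congr 1 with z
      congr 1
      exact Subsingleton.elim _ _
    rw [this]
    exact memLp_const _
  · have : _root_.avgRisk P L = fun x => ∫ z, risk P L (Function.update z ⟨0, hN⟩ x)
        ∂(Measure.pi fun _ : Fin N => P) := by
      ext x
      exact avgRisk_eq h.measurable h.symmetric _ x
    rw [this]
    exact (h.memLp_risk_update hq _).integral_prod_right hq

theorem memLp_influence (hq : 1 ≤ q) : MemLp (influence P L) q P :=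
  (h.memLp_avgLoss hq).add ((h.memLp_avgRisk hq).const_mul _)

/-- `N · avgRisk` alone may be of order `N`; only its differences are controlled. With `w.1` against
`w.2` at position `k` and the other points random, the risk difference has the law bounded by
`norm_risk_diff`, and Jensen's inequality averages over the other points. -/
theorem eLpNorm_avgRisk_sub_le (hq : 1 ≤ q) :
    eLpNorm (fun w : 𝒳 × 𝒳 => (N : ℝ) * (_root_.avgRisk P L w.1 - _root_.avgRisk P L w.2)) q
      (P.prod P) ≤
      ENNReal.ofReal (N * BR) := by
  rcases N.eq_zero_or_pos with hN | hN
  · simp [hN]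
  set k : Fin N := ⟨0, hN⟩
  set π := Measure.pi fun _ : Fin N => P
  set D : (𝒳 × 𝒳) × (Fin N → 𝒳) → ℝ := fun w =>
    risk P L (Function.update w.2 k w.1.1) - risk P L (Function.update w.2 k w.1.2) with hD
  have hmp : MeasurePreserving
      (fun w : (𝒳 × 𝒳) × (Fin N → 𝒳) => (w.1.2, Function.update w.2 k w.1.1))
      ((P.prod P).prod π) (P.prod π) := by
    have e1 := (Measure.measurePreserving_swap (μ := P) (ν := P)).prod (MeasurePreserving.id π)
    have e2 := measurePreserving_prodAssoc P P π
    have e3 := (MeasurePreserving.id P).prod ((measurePreserving_update P k).comp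
      (Measure.measurePreserving_swap (μ := P) (ν := π)))
    exact e3.comp (e2.comp e1)
  have hRm := measurable_risk (P := P) h.measurable
  have hgm : Measurable fun w : 𝒳 × (Fin N → 𝒳) =>
      risk P L w.2 - risk P L (Function.update w.2 k w.1) :=
    (hRm.comp measurable_snd).sub
      (hRm.comp (Measurable.function_update measurable_snd measurable_fst k))
  have hDeq : D = (fun w : 𝒳 × (Fin N → 𝒳) =>
      risk P L w.2 - risk P L (Function.update w.2 k w.1)) ∘
      fun w : (𝒳 × 𝒳) × (Fin N → 𝒳) => (w.1.2, Function.update w.2 k w.1.1) := by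
    ext w
    simp [hD]
  have hDb : eLpNorm D q ((P.prod P).prod π) ≤ ENNReal.ofReal BR := by
    rw [hDeq, eLpNorm_comp_measurePreserving hgm.aestronglyMeasurable hmp]
    exact h.norm_risk_diff k
  have hDm : AEStronglyMeasurable D ((P.prod P).prod π) := by
    rw [hDeq]; exact (hgm.comp hmp.measurable).aestronglyMeasurable
  have hint := ((h.memLp_risk_update hq k).integrable (by exact_mod_cast hq)).prod_right_ae
  have h1 : ∀ᵐ w ∂(P.prod P), Integrable (fun z => risk P L (Function.update z k w.1)) π :=
    measurePreserving_fst.quasiMeasurePreserving.ae hint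
  have h2 : ∀ᵐ w ∂(P.prod P), Integrable (fun z => risk P L (Function.update z k w.2)) π :=
    measurePreserving_snd.quasiMeasurePreserving.ae hint
  have h3 : eLpNorm (fun w : 𝒳 × 𝒳 => _root_.avgRisk P L w.1 - _root_.avgRisk P L w.2) q
      (P.prod P) ≤
      ENNReal.ofReal BR := by
    refine le_trans (le_of_eq (eLpNorm_congr_ae ?_))
      ((eLpNorm_integral_prod_right_le hDm hq).trans hDb)
    filter_upwards [h1, h2] with w hw1 hw2
    rw [avgRisk_eq h.measurable h.symmetric k, avgRisk_eq h.measurable h.symmetric k,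
      ← integral_sub hw1 hw2]
  have h4 := eLpNorm_const_smul (N : ℝ)
    (fun w : 𝒳 × 𝒳 => _root_.avgRisk P L w.1 - _root_.avgRisk P L w.2) (q : ℝ≥0∞) (P.prod P)
  rw [ENNReal.ofReal_mul (by positivity)]
  refine (le_of_eq h4).trans ?_
  gcongr
  rw [Real.enorm_eq_ofReal (by positivity)]

theorem ae_integral_loss_update (hq : 1 ≤ q) (k : Fin N) :
    ∀ᵐ y ∂P, Integrable (fun w : 𝒳 × (Fin N → 𝒳) => L w.1 (Function.update w.2 k y))
      (P.prod (Measure.pi fun _ => P)) ∧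
      ∫ w, L w.1 (Function.update w.2 k y) ∂(P.prod (Measure.pi fun _ => P)) =
        _root_.avgRisk P L y := by
  set π := Measure.pi fun _ : Fin N => P
  have hmp : MeasurePreserving
      (fun w : 𝒳 × (𝒳 × (Fin N → 𝒳)) => (w.2.1, Function.update w.2.2 k w.1))
      (P.prod (P.prod π)) (P.prod π) :=
    (measurePreserving_prod_update P P k).comp
      (Measure.measurePreserving_swap (μ := P) (ν := P.prod π))
  have hint := (hmp.integrable_comp_of_integrable
    (h.memLp_loss.integrable (by exact_mod_cast hq))).prod_right_ae
  filter_upwards [hint] with y hy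
  have hy' : Integrable (fun w : 𝒳 × (Fin N → 𝒳) => L w.1 (Function.update w.2 k y))
      (P.prod π) := hy
  refine ⟨hy', ?_⟩
  rw [integral_prod_symm _ hy', avgRisk_eq h.measurable h.symmetric k]
  rfl

end StableNorms

/-- Efron–Stein in the training sample, with the test point as frozen parameter. -/
theorem StableNorms.eLpNorm_loss_sub_avgLoss_le {k : ℕ} {B₀ B₁ B₂ BR : ℝ}
    (h : StableNorms P L (2 * k) B₀ B₁ B₂ BR) (hk : 1 ≤ k) (hB₁ : 0 < B₁) :
    eLpNorm (fun w : 𝒳 × (Fin N → 𝒳) => L w.1 w.2 - avgLoss P L w.1) ((2 * k : ℕ) : ℝ≥0∞)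
      (P.prod (Measure.pi fun _ => P)) ≤
      ENNReal.ofReal (Real.sqrt (8 * k ^ 2 * (N + 1)) * B₁) :=
  eLpNorm_sub_integral_pi_le P P hk hB₁ N (fun w => L w.1 w.2) h.memLp_loss h.norm_diff

end Averages

theorem dropFold_update_of_trainIdx_eq {𝒳 : Type*} {n V v : ℕ} {k : Fin (trainSize n V)}
    {i : Fin n} (hk : trainIdx n V v k = i) (x : Fin n → 𝒳) (y : 𝒳) :
    dropFold V v (Function.update x i y) = Function.update (dropFold V v x) k y := by
  subst hk; exact dropFold_update_trainIdx v k x y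

theorem measurable_dropFold {𝒳 : Type*} [MeasurableSpace 𝒳] {n : ℕ} (V v : ℕ) :
    Measurable (dropFold (𝒳 := 𝒳) (n := n) V v) :=
  measurable_pi_lambda _ fun _ => measurable_pi_apply _

/-! ### First and second order differences at arbitrary distinct indices. -/

section Differences

variable {Ω 𝒳 ι : Type*} [MeasurableSpace Ω] [MeasurableSpace 𝒳] {μ : Measure Ω}
  [IsProbabilityMeasure μ] {P : Measure 𝒳} {U : ι → Ω → 𝒳}
  {N q : ℕ} {L : 𝒳 → (Fin N → 𝒳) → ℝ} {B₀ B₁ B₂ BR : ℝ}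

theorem IsIID.eLpNorm_diff_le (hU : IsIID μ P U) (h : StableNorms P L q B₀ B₁ B₂ BR) (k : Fin N)
    {t t₁ : ι} {e : Fin N → ι} (he : Function.Injective e)
    (ht : ∀ k, e k ≠ t) (ht₁ : ∀ k, e k ≠ t₁) (htt : t ≠ t₁) :
    eLpNorm (fun ω => L (U t ω) (fun j => U (e j) ω) -
      L (U t ω) (Function.update (fun j => U (e j) ω) k (U t₁ ω))) q μ ≤ ENNReal.ofReal B₁ := by
  have hmp := hU.measurePreserving_triple he ht ht₁ htt
  have hg : Measurable (fun w : (𝒳 × (Fin N → 𝒳)) × 𝒳 =>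
      L w.1.1 w.1.2 - L w.1.1 (Function.update w.1.2 k w.2)) :=
    (h.measurable.loss_comp (by fun_prop) (by fun_prop)).sub
      (h.measurable.loss_comp (by fun_prop)
        (Measurable.function_update (by fun_prop) (by fun_prop) k))
  refine le_trans (le_of_eq ?_) (h.norm_diff k)
  rw [← eLpNorm_comp_measurePreserving hg.aestronglyMeasurable hmp]
  rfl

theorem IsIID.eLpNorm_diff_diff_le (hU : IsIID μ P U) (h : StableNorms P L q B₀ B₁ B₂ BR)
    {k l : Fin N} (hkl : k ≠ l)
    {t t₁ t₂ : ι} {e : Fin N → ι} (he : Function.Injective e)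
    (ht : ∀ k, e k ≠ t) (ht₁ : ∀ k, e k ≠ t₁) (ht₂ : ∀ k, e k ≠ t₂)
    (h01 : t ≠ t₁) (h02 : t ≠ t₂) (h12 : t₁ ≠ t₂) :
    eLpNorm (fun ω => (L (U t ω) (fun j => U (e j) ω) -
        L (U t ω) (Function.update (fun j => U (e j) ω) k (U t₁ ω))) -
      (L (U t ω) (Function.update (fun j => U (e j) ω) l (U t₂ ω)) -
        L (U t ω) (Function.update (Function.update (fun j => U (e j) ω) l (U t₂ ω)) k (U t₁ ω))))
      q μ ≤ ENNReal.ofReal B₂ := by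
  have hmp := hU.measurePreserving_quadruple he ht ht₁ ht₂ h01 h02 h12
  have hg : Measurable (fun w : ((𝒳 × (Fin N → 𝒳)) × 𝒳) × 𝒳 =>
      (L w.1.1.1 w.1.1.2 - L w.1.1.1 (Function.update w.1.1.2 k w.1.2)) -
      (L w.1.1.1 (Function.update w.1.1.2 l w.2) -
        L w.1.1.1 (Function.update (Function.update w.1.1.2 l w.2) k w.1.2))) := by
    refine ((h.measurable.loss_comp (by fun_prop) (by fun_prop)).sub
      (h.measurable.loss_comp (by fun_prop) ?_)).sub
      ((h.measurable.loss_comp (by fun_prop) ?_).sub (h.measurable.loss_comp (by fun_prop) ?_))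
    · exact Measurable.function_update (by fun_prop) (by fun_prop) k
    · exact Measurable.function_update (by fun_prop) (by fun_prop) l
    · exact Measurable.function_update
        (Measurable.function_update (by fun_prop) (by fun_prop) l) (by fun_prop) k
  refine le_trans (le_of_eq ?_) (h.norm_diff_diff k l hkl)
  rw [← eLpNorm_comp_measurePreserving hg.aestronglyMeasurable hmp]
  rfl

end Differences

/-! ### Mean and stability of the cross term. -/

section CrossTerm

variable {Ω 𝒳 : Type*} [MeasurableSpace Ω] [MeasurableSpace 𝒳] {μ : Measure Ω}
  [IsProbabilityMeasure μ] {P : Measure 𝒳} [IsProbabilityMeasure P] {n V q : ℕ}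
  {X₀ : Ω → 𝒳} {X X' : Fin n → Ω → 𝒳} {L : 𝒳 → (Fin (trainSize n V) → 𝒳) → ℝ}
  {B₀ B₁ B₂ BR : ℝ}

theorem some_inl_trainIdx_injective (n V v : ℕ) : Function.Injective fun k =>
    (some (Sum.inl (trainIdx n V v k)) : Option (Fin n ⊕ Fin n)) :=
  (Option.some_injective _).comp (Sum.inl_injective.comp (trainIdx_injective n V v))

theorem measurable_crossTerm (hL : Measurable (Function.uncurry L)) (i : Fin n) :
    Measurable fun w : (𝒳 × 𝒳) × (Fin n → 𝒳) => crossTerm V L i w.1.1 w.1.2 w.2 := by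
  refine Finset.measurable_sum _ fun j _ => (hL.loss_comp (by fun_prop) ?_).sub
    (hL.loss_comp (by fun_prop) ?_)
  · exact (measurable_dropFold V _).comp (Measurable.function_update (by fun_prop) (by fun_prop) i)
  · exact (measurable_dropFold V _).comp (Measurable.function_update (by fun_prop) (by fun_prop) i)

/-- Each `j` outside the fold of `i` contributes a difference of `avgRisk`, since its model has the
inserted value among its training points. There are `ñ` such `j`, which explains the factor `ñ` in
`influence`. -/
theorem ae_integral_crossTerm (hV : V ∣ n) (h : StableNorms P L q B₀ B₁ B₂ BR) (hq : 1 ≤ q)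
    (i : Fin n) : ∀ᵐ y ∂(P.prod P),
      ∫ z, crossTerm V L i y.1 y.2 z ∂(Measure.pi fun _ : Fin n => P) =
        (trainSize n V : ℝ) * (_root_.avgRisk P L y.1 - _root_.avgRisk P L y.2) := by
  have key : ∀ j : Fin n, foldOf V j ≠ foldOf V i → ∀ᵐ y ∂P,
      Integrable (fun z => L (z j) (dropFold V (foldOf V j) (Function.update z i y)))
        (Measure.pi fun _ : Fin n => P) ∧
      ∫ z, L (z j) (dropFold V (foldOf V j) (Function.update z i y))
        ∂(Measure.pi fun _ : Fin n => P) = _root_.avgRisk P L y := by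
    intro j hj
    obtain ⟨k, hk⟩ := exists_trainIdx_eq hV (foldOf_lt hV j) hj.symm
    have hmp := (isIID_eval (ι := Fin n) P).measurePreserving_pair (t := j)
      (trainIdx_injective n V (foldOf V j)) (trainIdx_ne_of_foldOf_eq hV rfl)
    filter_upwards [h.ae_integral_loss_update hq k] with y hy
    have e : (fun z : Fin n → 𝒳 => L (z j) (dropFold V (foldOf V j) (Function.update z i y))) =
        (fun w : 𝒳 × (Fin (trainSize n V) → 𝒳) => L w.1 (Function.update w.2 k y)) ∘
          fun z => (z j, fun l => z (trainIdx n V (foldOf V j) l)) := by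
      ext z
      rw [dropFold_update_of_trainIdx_eq hk]
      rfl
    rw [e]
    refine ⟨hmp.integrable_comp_of_integrable hy.1, ?_⟩
    rw [← hy.2]
    conv_rhs => rw [← hmp.map_eq]
    rw [integral_map hmp.aemeasurable]
    · rfl
    · rw [hmp.map_eq]; exact hy.1.1
  have h1 : ∀ᵐ y ∂(P.prod P), ∀ j : Fin n, foldOf V j ≠ foldOf V i → _ :=
    ae_all_iff.2 fun j => (Filter.eventually_imp_distrib_left).2 fun hj =>
      (measurePreserving_fst (μ := P) (ν := P)).quasiMeasurePreserving.ae (key j hj)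
  have h2 : ∀ᵐ y ∂(P.prod P), ∀ j : Fin n, foldOf V j ≠ foldOf V i → _ :=
    ae_all_iff.2 fun j => (Filter.eventually_imp_distrib_left).2 fun hj =>
      (measurePreserving_snd (μ := P) (ν := P)).quasiMeasurePreserving.ae (key j hj)
  filter_upwards [h1, h2] with y hy1 hy2
  have hmem : ∀ j ∈ Finset.univ.filter (fun j : Fin n => foldOf V j ≠ foldOf V i),
      foldOf V j ≠ foldOf V i := fun j hj => (Finset.mem_filter.1 hj).2
  unfold crossTerm
  refine (integral_finsetSum _ fun j hj =>
    (hy1 j (hmem j hj)).1.sub (hy2 j (hmem j hj)).1).trans ?_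
  rw [Finset.sum_congr rfl fun j hj => by
    rw [integral_sub' (hy1 j (hmem j hj)).1 (hy2 j (hmem j hj)).1, (hy1 j (hmem j hj)).2,
      (hy2 j (hmem j hj)).2]]
  rw [Finset.sum_const, card_filter_foldOf_ne hV (foldOf_lt hV i), nsmul_eq_mul]

theorem memLp_crossTerm (hV : V ∣ n) (hX : IsIIDSample μ P X₀ X X')
    (h : StableNorms P L q B₀ B₁ B₂ BR) (i : Fin n) :
    MemLp (fun ω => crossTerm V L i (X i ω) (X' i ω) fun j => X j ω) q μ := by
  refine memLp_finsetSum _ fun j hj => ?_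
  have hj : foldOf V j ≠ foldOf V i := (Finset.mem_filter.1 hj).2
  obtain ⟨k, hk⟩ := exists_trainIdx_eq hV (foldOf_lt hV j) hj.symm
  have hmp := hX.isIID.measurePreserving_triple (t := some (Sum.inl j)) (t₁ := some (Sum.inr i))
    (some_inl_trainIdx_injective n V (foldOf V j))
    (by simpa using trainIdx_ne_of_foldOf_eq hV rfl) (by simp) (by simp)
  refine MemLp.sub ?_ ?_
  · simp only [Function.update_eq_self]
    exact h.memLp_loss.comp_measurePreserving (measurePreserving_fst.comp hmp)
  · simp only [dropFold_update_of_trainIdx_eq hk]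
    exact h.memLp_loss.comp_measurePreserving ((measurePreserving_prod_update P P k).comp hmp)

omit [IsProbabilityMeasure P] in
-- Resampling entry `l` affects the summand `j` in one of three ways. If `j = l`, only the test
-- point changes, giving two first order differences. If `j ≠ l` lies in the fold of `l`, nothing
-- changes. Otherwise `l` and `i` are distinct training points of the model tested at `j`, giving
-- one second order difference.
theorem eLpNorm_crossTerm_sub_le (hV : V ∣ n) (hX : IsIIDSample μ P X₀ X X')
    (h : StableNorms P L q B₀ B₁ B₂ BR) (hq : 1 ≤ q) (hB₁ : 0 ≤ B₁) (hB₂ : 0 ≤ B₂)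
    {i l : Fin n} (hli : l ≠ i) :
    eLpNorm (fun ω => crossTerm V L i (X i ω) (X' i ω) (fun j => X j ω) -
      crossTerm V L i (X i ω) (X' i ω) (Function.update (fun j => X j ω) l (X' l ω))) q μ ≤
      ENNReal.ofReal (2 * B₁ + n * B₂) := by
  have hU := hX.isIID
  have hq' : (1 : ℝ≥0∞) ≤ q := by exact_mod_cast hq
  set T : Fin n → (Fin n → 𝒳) → Ω → ℝ := fun j z ω =>
    L (z j) (dropFold V (foldOf V j) (Function.update z i (X i ω))) -
      L (z j) (dropFold V (foldOf V j) (Function.update z i (X' i ω))) with hT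
  have hXm : ∀ j, Measurable (X j) := hX.measurable_data
  have hX'm : ∀ j, Measurable (X' j) := hX.measurable_copy
  set D : Fin n → Ω → ℝ := fun j ω => T j (fun j => X j ω) ω -
    T j (Function.update (fun j => X j ω) l (X' l ω)) ω with hD
  have hXX : Measurable fun ω => fun j => X j ω := measurable_pi_lambda _ hXm
  have hXl : Measurable fun ω => Function.update (fun j => X j ω) l (X' l ω) :=
    Measurable.function_update hXX (hX'm l) l
  have hTm : ∀ j (Z : Ω → Fin n → 𝒳), Measurable Z → Measurable fun ω => T j (Z ω) ω := by
    intro j Z hZ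
    exact (h.measurable.loss_comp hZ.eval ((measurable_dropFold V _).comp
        (Measurable.function_update hZ (hXm i) i))).sub
      (h.measurable.loss_comp hZ.eval ((measurable_dropFold V _).comp
        (Measurable.function_update hZ (hX'm i) i)))
  have hDm : ∀ j, Measurable (D j) := fun j => (hTm j _ hXX).sub (hTm j _ hXl)
  have hDb : ∀ j ∈ Finset.univ.filter (fun j : Fin n => foldOf V j ≠ foldOf V i),
      eLpNorm (D j) q μ ≤ (if j = l then ENNReal.ofReal (2 * B₁) else 0) + ENNReal.ofReal B₂ := by
    intro j hj
    have hj : foldOf V j ≠ foldOf V i := (Finset.mem_filter.1 hj).2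
    have hji : j ≠ i := fun h => hj (h ▸ rfl)
    obtain ⟨k, hk⟩ := exists_trainIdx_eq hV (foldOf_lt hV j) hj.symm
    have hinj := some_inl_trainIdx_injective n V (foldOf V j)
    have hne : ∀ k, (some (Sum.inl (trainIdx n V (foldOf V j) k)) : Option (Fin n ⊕ Fin n)) ≠
      some (Sum.inl j) := by simpa using trainIdx_ne_of_foldOf_eq hV rfl
    by_cases hjl : foldOf V j = foldOf V l
    · have e1 : ∀ ω y, dropFold V (foldOf V j)
          (Function.update (Function.update (fun j => X j ω) l (X' l ω)) i y) =
          dropFold V (foldOf V j) (Function.update (fun j => X j ω) i y) := by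
        intro ω y
        rw [Function.update_comm hli, dropFold_update_of_foldOf_eq hV hjl.symm]
      by_cases hjl' : j = l
      · subst hjl'
        rw [if_pos rfl]
        have b1 := hU.eLpNorm_diff_le h k (t := some (Sum.inl j)) (t₁ := some (Sum.inr i)) hinj hne
          (by simp) (by simp)
        have b2 := hU.eLpNorm_diff_le h k (t := some (Sum.inr j)) (t₁ := some (Sum.inr i)) hinj
          (by simp) (by simp) (by simpa using hji)
        have e : D j = (fun ω => L (X j ω) (dropFold V (foldOf V j) fun j => X j ω) -
              L (X j ω) (Function.update (dropFold V (foldOf V j) fun j => X j ω) k (X' i ω))) -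
            fun ω => L (X' j ω) (dropFold V (foldOf V j) fun j => X j ω) -
              L (X' j ω) (Function.update (dropFold V (foldOf V j) fun j => X j ω) k (X' i ω)) := by
          ext ω
          simp only [hD, hT, Pi.sub_apply, e1, Function.update_self,
            dropFold_update_of_trainIdx_eq hk]
          rw [← dropFold_update_of_trainIdx_eq hk (fun j => X j ω) (X i ω), Function.update_eq_self]
        have m1 : Measurable fun ω => dropFold V (foldOf V j) fun j => X j ω :=
          (measurable_dropFold V _).comp hXX
        rw [e]
        refine (eLpNorm_sub_le ?_ ?_ hq').trans ?_
        · exact ((h.measurable.loss_comp (hXm j) m1).sub (h.measurable.loss_comp (hXm j)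
            (m1.function_update (hX'm i) k))).aestronglyMeasurable
        · exact ((h.measurable.loss_comp (hX'm j) m1).sub (h.measurable.loss_comp (hX'm j)
            (m1.function_update (hX'm i) k))).aestronglyMeasurable
        · refine (add_le_add b1 b2).trans ?_
          rw [← ENNReal.ofReal_add hB₁ hB₁, two_mul]
          exact le_self_add
      · have e : D j = 0 := by
          ext ω
          simp only [hD, hT, e1, Function.update_of_ne hjl', sub_self, Pi.zero_apply]
        rw [e]; simp
    · obtain ⟨k', hk'⟩ := exists_trainIdx_eq hV (foldOf_lt hV j) (Ne.symm hjl)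
      have hjl' : j ≠ l := fun h => hjl (h ▸ rfl)
      have hkk' : k ≠ k' := by
        rintro rfl; exact hli (hk'.symm.trans hk)
      have b := hU.eLpNorm_diff_diff_le h hkk' (t := some (Sum.inl j)) (t₁ := some (Sum.inr i))
        (t₂ := some (Sum.inr l)) hinj hne (by simp) (by simp) (by simp) (by simp)
        (by simpa using hli.symm)
      refine le_trans (le_of_eq ?_) (b.trans le_add_self)
      congr 1
      ext ω
      have e2 : Function.update (Function.update (fun j => X j ω) l (X' l ω)) i (X i ω) =
          Function.update (fun j => X j ω) l (X' l ω) := by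
        rw [Function.update_eq_self_iff, Function.update_of_ne hli.symm]
      simp only [hD, hT, e2, Function.update_of_ne hjl', Function.update_eq_self,
        dropFold_update_of_trainIdx_eq hk, dropFold_update_of_trainIdx_eq hk']
      rfl
  have esum : (fun ω => crossTerm V L i (X i ω) (X' i ω) (fun j => X j ω) -
      crossTerm V L i (X i ω) (X' i ω) (Function.update (fun j => X j ω) l (X' l ω))) =
      ∑ j with foldOf V j ≠ foldOf V i, D j := by
    ext ω
    rw [Finset.sum_apply, crossTerm, crossTerm, ← Finset.sum_sub_distrib]
  rw [esum]
  refine (eLpNorm_sum_le (fun j _ => (hDm j).aestronglyMeasurable) hq').trans ?_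
  refine (Finset.sum_le_sum hDb).trans ?_
  refine (Finset.sum_le_sum_of_subset (Finset.subset_univ _)).trans ?_
  rw [Finset.sum_add_distrib, Finset.sum_ite_eq' Finset.univ l, if_pos (Finset.mem_univ l),
    Finset.sum_const, Finset.card_univ, Fintype.card_fin, nsmul_eq_mul,
    ENNReal.ofReal_add (by positivity) (by positivity),
    ENNReal.ofReal_mul (by positivity : (0 : ℝ) ≤ n), ENNReal.ofReal_natCast]

end CrossTerm

/-! ### Approximating `n ∇ᵢ R̂_cv` by a function of `(X_i, X'_i)`. -/

section Linearization

variable {Ω 𝒳 : Type*} [MeasurableSpace Ω] [MeasurableSpace 𝒳] {μ : Measure Ω}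
  [IsProbabilityMeasure μ] {P : Measure 𝒳} [IsProbabilityMeasure P] {n V : ℕ}
  {X₀ : Ω → 𝒳} {X X' : Fin n → Ω → 𝒳} {L : 𝒳 → (Fin (trainSize n V) → 𝒳) → ℝ}
  {B₀ B₁ B₂ BR : ℝ}

omit [IsProbabilityMeasure P] in
theorem IsIIDSample.measurePreserving_data_copy (hX : IsIIDSample μ P X₀ X X') (i : Fin n) :
    MeasurePreserving (fun ω => (X i ω, X' i ω)) μ (P.prod P) :=
  hX.isIID.measurePreserving_prod (e := fun _ : Unit => some (Sum.inl i))
    (e' := fun _ : Unit => some (Sum.inr i)) (φ := fun w => w ()) (ψ := fun w => w ())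
    (by simp) (measurable_pi_apply _) (measurable_pi_apply _)
    (hX.isIID.measurePreserving_apply (some (Sum.inl i)))
    (hX.isIID.measurePreserving_apply (some (Sum.inr i)))

omit [IsProbabilityMeasure P] in
-- `X₀` takes the place of `X_i` in the data vector, so that the vector becomes independent of the
-- pair `(X_i, X'_i)`.
theorem IsIIDSample.measurePreserving_data_copy_update (hX : IsIIDSample μ P X₀ X X')
    (i : Fin n) :
    MeasurePreserving (fun ω => ((X i ω, X' i ω), Function.update (fun j => X j ω) i (X₀ ω))) μ
      ((P.prod P).prod (Measure.pi fun _ : Fin n => P)) ∧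
    ∀ l, l ≠ i → MeasurePreserving
      (fun ω => (((X i ω, X' i ω), Function.update (fun j => X j ω) i (X₀ ω)), X' l ω)) μ
      (((P.prod P).prod (Measure.pi fun _ : Fin n => P)).prod P) := by
  have hU := hX.isIID
  set e₁ : Bool → Option (Fin n ⊕ Fin n) := fun c => some (cond c (Sum.inl i) (Sum.inr i))
  set e₂ : Fin n → Option (Fin n ⊕ Fin n) := Function.update (fun j => some (Sum.inl j)) i none
    with he₂
  have h₂ : ∀ ω, (fun j => (e₂ j).elim X₀ (Sum.elim X X') ω) =
      Function.update (fun j => X j ω) i (X₀ ω) := by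
    intro ω
    ext j
    by_cases hj : j = i
    · subst hj; simp [he₂]
    · simp [he₂, Function.update_of_ne hj]
  have hinj : Function.Injective e₂ := by
    intro j k hjk
    by_cases hj : j = i <;> by_cases hk : k = i <;>
      simp_all
  have hne : ∀ c j, e₁ c ≠ e₂ j := by
    intro c j
    by_cases hj : j = i
    · subst hj; simp [e₁, he₂]
    · cases c <;> simp [e₁, he₂, Function.update_of_ne hj, Ne.symm hj]
  have hp := hU.measurePreserving_prod (e := e₁) (e' := e₂)
    (φ := fun w => (w true, w false)) (ψ := id) hne (by fun_prop) measurable_id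
    (hX.measurePreserving_data_copy i) (hU.measurePreserving_comp hinj)
  refine ⟨?_, fun l hl => ?_⟩
  · simp only [id, h₂] at hp
    exact hp
  · have ht := hU.measurePreserving_prod (e := Sum.elim e₁ e₂)
      (e' := fun _ : Unit => some (Sum.inr l))
      (φ := fun w => ((w (Sum.inl true), w (Sum.inl false)), fun j => w (Sum.inr j)))
      (ψ := fun w => w ()) (by
        rintro (c | j) _
        · cases c <;> simp [e₁, hl.symm]
        · by_cases hj : j = i
          · subst hj; simp [he₂]
          · simp [he₂, Function.update_of_ne hj])
      (by fun_prop) (by fun_prop) hp (hU.measurePreserving_apply (some (Sum.inr l)))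
    simp only [Sum.elim_inr, h₂] at ht
    exact ht

/-- Efron–Stein with the pair `(X_i, X'_i)` frozen; the coordinate `i` of the vector has no effect.
-/
theorem eLpNorm_crossTerm_sub_avgRisk_le {k : ℕ} (hk : 1 ≤ k) (hV : V ∣ n)
    (hX : IsIIDSample μ P X₀ X X') (h : StableNorms P L (2 * k) B₀ B₁ B₂ BR) (hB₁ : 0 < B₁)
    (hB₂ : 0 ≤ B₂) (i : Fin n) :
    eLpNorm (fun ω => crossTerm V L i (X i ω) (X' i ω) (fun j => X j ω) -
      (trainSize n V : ℝ) * (_root_.avgRisk P L (X i ω) - _root_.avgRisk P L (X' i ω)))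
      ((2 * k : ℕ) : ℝ≥0∞) μ ≤
      ENNReal.ofReal (Real.sqrt (8 * k ^ 2 * (n + 1)) * (2 * B₁ + n * B₂)) := by
  have h2k : 1 ≤ 2 * k := by omega
  obtain ⟨hmp, hmp'⟩ := hX.measurePreserving_data_copy_update i
  set π := Measure.pi fun _ : Fin n => P
  set F : (𝒳 × 𝒳) × (Fin n → 𝒳) → ℝ := fun w => crossTerm V L i w.1.1 w.1.2 w.2 with hF
  have hFm : Measurable F := measurable_crossTerm h.measurable i
  have hFL : MemLp F ((2 * k : ℕ) : ℝ≥0∞) ((P.prod P).prod π) := by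
    rw [← hmp.map_eq, memLp_map_measure_iff hFm.aestronglyMeasurable hmp.aemeasurable]
    refine (memLp_crossTerm hV hX h i).ae_eq (Filter.Eventually.of_forall fun ω => ?_)
    simp only [hF, Function.comp_apply, crossTerm_update_self]
  have hconc := eLpNorm_sub_integral_pi_le (P.prod P) P hk (b := 2 * B₁ + n * B₂)
    (by positivity) n F hFL fun l => by
      have hDm : Measurable fun w : ((𝒳 × 𝒳) × (Fin n → 𝒳)) × 𝒳 =>
          F w.1 - F (w.1.1, Function.update w.1.2 l w.2) :=
        (hFm.comp measurable_fst).sub (hFm.comp ((measurable_fst.comp measurable_fst).prodMk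
          (Measurable.function_update (by fun_prop) (by fun_prop) l)))
      by_cases hl : l = i
      · subst hl
        simp [hF, crossTerm_update_self]
      · rw [← eLpNorm_comp_measurePreserving hDm.aestronglyMeasurable (hmp' l hl)]
        refine le_trans (le_of_eq ?_) (eLpNorm_crossTerm_sub_le hV hX h h2k hB₁.le hB₂ hl)
        congr 1
        ext ω
        simp only [hF, Function.comp_apply, crossTerm_update_self]
        rw [Function.update_comm (Ne.symm hl), crossTerm_update_self]
  have hm : AEStronglyMeasurable (fun w => F w - ∫ z, F (w.1, z) ∂π) ((P.prod P).prod π) :=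
    hFm.aestronglyMeasurable.sub (hFL.integral_prod_right h2k).1.comp_fst
  rw [← eLpNorm_comp_measurePreserving hm hmp] at hconc
  refine le_trans (le_of_eq (eLpNorm_congr_ae ?_)) hconc
  have hae := (hX.measurePreserving_data_copy i).quasiMeasurePreserving.ae
    (ae_integral_crossTerm hV h h2k i)
  filter_upwards [hae] with ω hω
  simp only [hF, Function.comp_apply, crossTerm_update_self]
  rw [hω]

/-- The linearization of `n ∇ᵢ R̂_cv`. -/
noncomputable def influenceDiff (P : Measure 𝒳) (X X' : Fin n → Ω → 𝒳)
    (L : 𝒳 → (Fin (trainSize n V) → 𝒳) → ℝ) (i : Fin n) (ω : Ω) : ℝ :=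
  influence P L (X i ω) - influence P L (X' i ω)

omit [IsProbabilityMeasure μ] in
theorem memLp_influenceDiff {q : ℕ} (hq : 1 ≤ q) (hX : IsIIDSample μ P X₀ X X')
    (h : StableNorms P L q B₀ B₁ B₂ BR) (i : Fin n) :
    MemLp (influenceDiff P X X' L i) q μ :=
  ((h.memLp_influence hq).comp_measurePreserving
    (hX.isIID.measurePreserving_apply (some (Sum.inl i)))).sub
  ((h.memLp_influence hq).comp_measurePreserving
    (hX.isIID.measurePreserving_apply (some (Sum.inr i))))

theorem eLpNorm_influenceDiff_le {q : ℕ} (hq : 1 ≤ q) (hX : IsIIDSample μ P X₀ X X')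
    (h : StableNorms P L q B₀ B₁ B₂ BR) (hB₀ : 0 ≤ B₀) (hBR : 0 ≤ BR) (i : Fin n) :
    eLpNorm (influenceDiff P X X' L i) q μ ≤
      ENNReal.ofReal (2 * B₀ + trainSize n V * BR) := by
  have hq' : (1 : ℝ≥0∞) ≤ q := by exact_mod_cast hq
  have hmp := hX.measurePreserving_data_copy i
  have hmL := measurable_avgLoss (P := P) h.measurable
  have hmR := measurable_avgRisk (P := P) h.measurable
  have e : influenceDiff P X X' L i =
      (avgLoss P L ∘ X i - avgLoss P L ∘ X' i) +
        (fun w : 𝒳 × 𝒳 => (trainSize n V : ℝ) *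
          (_root_.avgRisk P L w.1 - _root_.avgRisk P L w.2)) ∘ fun ω => (X i ω, X' i ω) := by
    ext ω
    simp only [influenceDiff, influence, Pi.add_apply, Pi.sub_apply, Function.comp_apply]
    ring
  have hmRR : Measurable (fun w : 𝒳 × 𝒳 => (trainSize n V : ℝ) *
      (_root_.avgRisk P L w.1 - _root_.avgRisk P L w.2)) :=
    ((hmR.comp measurable_fst).sub (hmR.comp measurable_snd)).const_mul _
  have m1 : AEStronglyMeasurable (avgLoss P L ∘ X i) μ :=
    (hmL.comp (hX.measurable_data i)).aestronglyMeasurable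
  have m2 : AEStronglyMeasurable (avgLoss P L ∘ X' i) μ :=
    (hmL.comp (hX.measurable_copy i)).aestronglyMeasurable
  rw [e]
  refine (eLpNorm_add_le (m1.sub m2) (hmRR.comp hmp.measurable).aestronglyMeasurable hq').trans ?_
  rw [ENNReal.ofReal_add (by positivity) (by positivity), two_mul, ENNReal.ofReal_add hB₀ hB₀]
  refine add_le_add ((eLpNorm_sub_le m1 m2 hq').trans (add_le_add ?_ ?_)) ?_
  · rw [eLpNorm_comp_measurePreserving hmL.aestronglyMeasurable
      ⟨hX.measurable_data i, hX.law_data i⟩]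
    exact h.eLpNorm_avgLoss_le hq
  · rw [eLpNorm_comp_measurePreserving hmL.aestronglyMeasurable
      ⟨hX.measurable_copy i, hX.law_copy i⟩]
    exact h.eLpNorm_avgLoss_le hq
  · rw [eLpNorm_comp_measurePreserving hmRR.aestronglyMeasurable hmp]
    exact h.eLpNorm_avgRisk_sub_le hq

omit [IsProbabilityMeasure μ] [IsProbabilityMeasure P] in
theorem measurable_nablaCV (hX : IsIIDSample μ P X₀ X X') (hL : Measurable (Function.uncurry L))
    (i : Fin n) : Measurable (nablaCV V X X' L i) := by
  have hcv : Measurable (cvRisk (n := n) V L) :=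
    (Finset.measurable_sum _ fun j _ =>
      hL.loss_comp (measurable_pi_apply _) (measurable_dropFold V _)).const_mul _
  have hXX : Measurable fun ω => fun j => X j ω := measurable_pi_lambda _ hX.measurable_data
  exact (hcv.comp hXX).sub
    (hcv.comp (Measurable.function_update hXX (hX.measurable_copy i) i))

/-- Three fluctuations add up: the losses at `X_i` and at `X'_i` around `avgLoss`, each costing
`B₁`, and the cross term around its conditional mean, costing `2B₁ + nB₂`. -/
theorem eLpNorm_mul_nablaCV_sub_le {k : ℕ} (hk : 1 ≤ k) (hV : V ∣ n)
    (hX : IsIIDSample μ P X₀ X X') (h : StableNorms P L (2 * k) B₀ B₁ B₂ BR) (hB₁ : 0 < B₁)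
    (hB₂ : 0 ≤ B₂) (i : Fin n) :
    eLpNorm (fun ω => n * nablaCV V X X' L i ω - influenceDiff P X X' L i ω)
      ((2 * k : ℕ) : ℝ≥0∞) μ ≤
      ENNReal.ofReal (Real.sqrt (8 * k ^ 2 * (n + 1)) * (4 * B₁ + n * B₂)) := by
  have h2k' : (1 : ℝ≥0∞) ≤ ((2 * k : ℕ) : ℝ≥0∞) := by exact_mod_cast (by omega : 1 ≤ 2 * k)
  have hmL := measurable_avgLoss (P := P) h.measurable
  have hmR := measurable_avgRisk (P := P) h.measurable
  have hinj := some_inl_trainIdx_injective n V (foldOf V i)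
  have hXX : Measurable fun ω => fun j => X j ω := measurable_pi_lambda _ hX.measurable_data
  set A : 𝒳 × (Fin (trainSize n V) → 𝒳) → ℝ := fun w => L w.1 w.2 - avgLoss P L w.1 with hA
  have hAm : Measurable A := (show Measurable fun w : 𝒳 × (Fin (trainSize n V) → 𝒳) =>
    L w.1 w.2 from h.measurable).sub (hmL.comp measurable_fst)
  have hAb := h.eLpNorm_loss_sub_avgLoss_le hk hB₁
  have hmp1 := hX.isIID.measurePreserving_pair (t := some (Sum.inl i)) hinj
    (by simpa using trainIdx_ne_of_foldOf_eq hV rfl)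
  have hmp2 := hX.isIID.measurePreserving_pair (t := some (Sum.inr i)) hinj (by simp)
  set C : Ω → ℝ := fun ω => crossTerm V L i (X i ω) (X' i ω) (fun j => X j ω) -
      (trainSize n V : ℝ) * (_root_.avgRisk P L (X i ω) - _root_.avgRisk P L (X' i ω)) with hC
  have hCm : Measurable C := ((measurable_crossTerm h.measurable i).comp
    (((hX.measurable_data i).prodMk (hX.measurable_copy i)).prodMk hXX)).sub
    (((hmR.comp (hX.measurable_data i)).sub (hmR.comp (hX.measurable_copy i))).const_mul _)
  have hCb : eLpNorm C _ μ ≤ _ := eLpNorm_crossTerm_sub_avgRisk_le hk hV hX h hB₁ hB₂ i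
  have e : (fun ω => n * nablaCV V X X' L i ω - influenceDiff P X X' L i ω) =
      (A ∘ (fun ω => (X i ω, dropFold V (foldOf V i) fun j => X j ω)) -
        A ∘ (fun ω => (X' i ω, dropFold V (foldOf V i) fun j => X j ω))) + C := by
    ext ω
    simp only [nablaCV, mul_nabla_cvRisk hV, influenceDiff, influence, Pi.add_apply, Pi.sub_apply,
      Function.comp_apply, hA, hC]
    ring
  have m1 := (hAm.comp hmp1.measurable).aestronglyMeasurable (μ := μ)
  have m2 := (hAm.comp hmp2.measurable).aestronglyMeasurable (μ := μ)
  have hNn : (trainSize n V : ℝ) ≤ n := by exact_mod_cast Nat.sub_le _ _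
  have hAb' : eLpNorm A ((2 * k : ℕ) : ℝ≥0∞) (P.prod (Measure.pi fun _ => P)) ≤
      ENNReal.ofReal (Real.sqrt (8 * k ^ 2 * (n + 1)) * B₁) := by
    refine hAb.trans (ENNReal.ofReal_le_ofReal ?_)
    gcongr
  have b1 := hAb'
  rw [← eLpNorm_comp_measurePreserving hAm.aestronglyMeasurable hmp1] at b1
  have b2 := hAb'
  rw [← eLpNorm_comp_measurePreserving hAm.aestronglyMeasurable hmp2] at b2
  rw [e]
  refine (eLpNorm_add_le (m1.sub m2) hCm.aestronglyMeasurable h2k').trans ?_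
  refine (add_le_add ((eLpNorm_sub_le m1 m2 h2k').trans (add_le_add b1 b2)) hCb).trans_eq ?_
  rw [← ENNReal.ofReal_add (by positivity) (by positivity),
    ← ENNReal.ofReal_add (by positivity) (by positivity)]
  congr 1
  ring

end Linearization

/-! ### Products, tails and the covariance identity. -/

theorem eLpNorm_mul_le_of_two_mul {Ω : Type*} [MeasurableSpace Ω] {μ : Measure Ω} {f g : Ω → ℝ}
    (hf : AEStronglyMeasurable f μ) (hg : AEStronglyMeasurable g μ) (k : ℕ) :
    eLpNorm (fun ω => f ω * g ω) k μ ≤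
      eLpNorm f ((2 * k : ℕ) : ℝ≥0∞) μ * eLpNorm g ((2 * k : ℕ) : ℝ≥0∞) μ := by
  have : ENNReal.HolderTriple ((2 * k : ℕ) : ℝ≥0∞) ((2 * k : ℕ) : ℝ≥0∞) (k : ℝ≥0∞) := by
    refine ⟨?_⟩
    rw [Nat.cast_mul, ENNReal.mul_inv (by simp) (by simp), ← add_mul, Nat.cast_ofNat,
      ENNReal.inv_two_add_inv_two, one_mul]
  have h := eLpNorm_smul_le_mul_eLpNorm (p := ((2 * k : ℕ) : ℝ≥0∞)) (q := ((2 * k : ℕ) : ℝ≥0∞))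
    (r := (k : ℝ≥0∞)) hg hf
  rw [smul_eq_mul] at h
  exact h

/-- Markov's inequality for the `k`-th moment at level `e · B` gives `e^{-k}` for each pair; the
union bound runs over `p²` pairs. -/
theorem measureReal_exists_exp_mul_le {Ω : Type*} [MeasurableSpace Ω] {μ : Measure Ω}
    [IsProbabilityMeasure μ] {p k : ℕ} (hk : 1 ≤ k) {f : Fin p → Fin p → Ω → ℝ} {B : ℝ}
    (hB : 0 < B) (hf : ∀ r s, AEStronglyMeasurable (f r s) μ)
    (h : ∀ r s, eLpNorm (f r s) k μ ≤ ENNReal.ofReal B) :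
    μ.real {ω | ∃ r s, Real.exp 1 * B ≤ |f r s ω|} ≤ (p : ℝ) ^ 2 * Real.exp (-k) := by
  have h1 : ∀ r s, μ.real {ω | Real.exp 1 * B ≤ |f r s ω|} ≤ Real.exp (-k) := by
    intro r s
    have hm := mul_meas_ge_le_pow_eLpNorm' μ (p := (k : ℝ≥0∞)) (by simp; omega)
      (ENNReal.natCast_ne_top k) (hf r s) (ENNReal.ofReal (Real.exp 1 * B))
    rw [ENNReal.toReal_natCast, ENNReal.rpow_natCast, ENNReal.rpow_natCast] at hm
    have hset : {ω | ENNReal.ofReal (Real.exp 1 * B) ≤ ‖f r s ω‖ₑ} =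
        {ω | Real.exp 1 * B ≤ |f r s ω|} := by
      ext ω
      simp only [Set.mem_ofPred_eq, Real.enorm_eq_ofReal_abs]
      exact ENNReal.ofReal_le_ofReal_iff (abs_nonneg _)
    rw [hset] at hm
    have hm2 := hm.trans (pow_le_pow_left₀ zero_le (h r s) k)
    rw [← ENNReal.ofReal_pow (by positivity), ← ENNReal.ofReal_pow hB.le,
      ← ENNReal.ofReal_toReal (measure_ne_top μ _), ← ENNReal.ofReal_mul (by positivity),
      ENNReal.ofReal_le_ofReal_iff (by positivity), mul_pow, ← Real.exp_nat_mul, mul_one] at hm2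
    rw [Real.exp_neg, ← one_div, le_div_iff₀ (Real.exp_pos _)]
    have hBk : 0 < B ^ k := by positivity
    refine le_of_mul_le_mul_left ?_ hBk
    calc _ = Real.exp k * B ^ k * (μ {ω | Real.exp 1 * B ≤ |f r s ω|}).toReal := by
          rw [Measure.real]; ring
      _ ≤ _ := by rw [mul_one]; exact hm2
  have hset : {ω | ∃ r s, Real.exp 1 * B ≤ |f r s ω|} =
      ⋃ r, ⋃ s, {ω | Real.exp 1 * B ≤ |f r s ω|} := by
    ext ω; simp
  rw [hset]
  calc _ ≤ ∑ r : Fin p, ∑ s : Fin p, μ.real {ω | Real.exp 1 * B ≤ |f r s ω|} :=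
        (measureReal_iUnion_fintype_le _).trans
          (Finset.sum_le_sum fun r _ => measureReal_iUnion_fintype_le _)
    _ ≤ ∑ r : Fin p, ∑ s : Fin p, Real.exp (-k) :=
        Finset.sum_le_sum fun r _ => Finset.sum_le_sum fun s _ => h1 r s
    _ = _ := by simp; ring

theorem two_mul_covariance_eq_integral {𝒳 : Type*} [MeasurableSpace 𝒳] {P : Measure 𝒳}
    [IsProbabilityMeasure P] {f g : 𝒳 → ℝ} (hf : MemLp f 2 P) (hg : MemLp g 2 P) :
    ∫ w, (f w.1 - f w.2) * (g w.1 - g w.2) ∂(P.prod P) = 2 * cov[f, g; P] := by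
  have hfi : Integrable f P := hf.integrable (by norm_num)
  have hgi : Integrable g P := hg.integrable (by norm_num)
  have hfg : Integrable (fun x => f x * g x) P := hf.integrable_mul hg
  have e : ∀ w : 𝒳 × 𝒳, (f w.1 - f w.2) * (g w.1 - g w.2) =
      (f w.1 * g w.1 + f w.2 * g w.2) - (f w.1 * g w.2 + g w.1 * f w.2) := fun w => by ring
  have i1 : Integrable (fun w : 𝒳 × 𝒳 => f w.1 * g w.1) (P.prod P) := hfg.comp_fst P
  have i2 : Integrable (fun w : 𝒳 × 𝒳 => f w.2 * g w.2) (P.prod P) := hfg.comp_snd P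
  have i3 : Integrable (fun w : 𝒳 × 𝒳 => f w.1 * g w.2) (P.prod P) := hfi.mul_prod hgi
  have i4 : Integrable (fun w : 𝒳 × 𝒳 => g w.1 * f w.2) (P.prod P) := hgi.mul_prod hfi
  have i12 : Integrable (fun w : 𝒳 × 𝒳 => f w.1 * g w.1 + f w.2 * g w.2) (P.prod P) := i1.add i2
  have i34 : Integrable (fun w : 𝒳 × 𝒳 => f w.1 * g w.2 + g w.1 * f w.2) (P.prod P) := i3.add i4
  simp only [e]
  rw [integral_sub i12 i34, integral_add i1 i2, integral_add i3 i4,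
    integral_fun_fst (fun x => f x * g x), integral_fun_snd (fun x => f x * g x),
    integral_prod_mul, integral_prod_mul, covariance_eq_sub hf hg]
  simp
  ring

/-! ### The product error under the stability assumptions. -/

section Main

variable {Ω 𝒳 : Type*} [MeasurableSpace Ω] [MeasurableSpace 𝒳] {μ : Measure Ω}
  [IsProbabilityMeasure μ] {P : Measure 𝒳} [IsProbabilityMeasure P] {n V p : ℕ}
  {X₀ : Ω → 𝒳} {X X' : Fin n → Ω → 𝒳} {L : Fin p → 𝒳 → (Fin (trainSize n V) → 𝒳) → ℝ}
  {a b α εl εR : ℝ}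

theorem sqrt_mul_rpow_neg_half_le {n k : ℕ} (hn : 0 < n) :
    Real.sqrt (8 * k ^ 2 * (n + 1)) * (n : ℝ) ^ (-(1 / 2) : ℝ) ≤ 4 * k := by
  have hn' : (1 : ℝ) ≤ n := by exact_mod_cast hn
  rw [Real.rpow_neg (by positivity), ← Real.sqrt_eq_rpow, ← div_eq_mul_inv,
    div_le_iff₀ (by positivity)]
  refine Real.sqrt_le_iff.2 ⟨by positivity, ?_⟩
  rw [mul_pow, mul_pow, Real.sq_sqrt (by positivity)]
  nlinarith [sq_nonneg (k : ℝ)]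

/-- `B₁` and `n B₂` are both `n^{-1/2} εl M`, with `M` the sub-Weibull moment of order `2k`, so `4B₁
+ nB₂` is five times this; the Efron–Stein factor is at most `4k √n`. -/
theorem IsStableLoss.eLpNorm_mul_nablaCV_sub_le (hX : IsIIDSample μ P X₀ X X')
    (h : IsStableLoss V μ P X₀ X X' L a b α εl εR) (ha : 0 < a) (hb : 0 < b) (hα : 0 < α)
    (hV : V ∣ n) (hl : 0 < εl) (hR : 0 < εR) {k : ℕ} (hk : 1 ≤ k) (r : Fin p) (i : Fin n) :
    eLpNorm (fun ω => n * nablaCV V X X' (L r) i ω - influenceDiff P X X' (L r) i ω)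
      ((2 * k : ℕ) : ℝ≥0∞) μ ≤ ENNReal.ofReal (20 * k * (εl * weibullMoment a b α (2 * k))) := by
  have hn' : (0 : ℝ) < n := by exact_mod_cast i.pos
  have hM : 0 < weibullMoment a b α (2 * k) := by
    have : (0 : ℝ) < k := by exact_mod_cast hk
    unfold weibullMoment; positivity
  have hs := h.stableNorms hX ha hb hα i.pos hl hR (q := 2 * k) (by omega) r
  refine (_root_.eLpNorm_mul_nablaCV_sub_le hk hV hX hs (by positivity) (by positivity) i).trans
    (ENNReal.ofReal_le_ofReal ?_)
  have e : (n : ℝ) * (n : ℝ) ^ (-(3 / 2) : ℝ) = (n : ℝ) ^ (-(1 / 2) : ℝ) := by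
    rw [← Real.rpow_one_add' hn'.le (by norm_num)]; norm_num
  have hc := sqrt_mul_rpow_neg_half_le (k := k) i.pos
  calc _ = 5 * (Real.sqrt (8 * k ^ 2 * (n + 1)) * (n : ℝ) ^ (-(1 / 2) : ℝ)) *
        (εl * weibullMoment a b α (2 * k)) := by
        rw [← mul_assoc (n : ℝ), ← mul_assoc (n : ℝ), e]; ring
    _ ≤ 5 * (4 * k) * (εl * weibullMoment a b α (2 * k)) := by gcongr
    _ = _ := by ring

theorem IsStableLoss.eLpNorm_influenceDiff_le (hX : IsIIDSample μ P X₀ X X')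
    (h : IsStableLoss V μ P X₀ X X' L a b α εl εR) (ha : 0 < a) (hb : 0 < b) (hα : 0 < α)
    (hl : 0 < εl) (hR : 0 < εR) {k : ℕ} (hk : 1 ≤ k) (r : Fin p) (i : Fin n) :
    eLpNorm (influenceDiff P X X' (L r) i) ((2 * k : ℕ) : ℝ≥0∞) μ ≤
      ENNReal.ofReal ((2 + εR) * weibullMoment a b α (2 * k)) := by
  have hn' : (0 : ℝ) < n := by exact_mod_cast i.pos
  have hM := weibullMoment_nonneg ha hb hα (2 * k)
  have hs := h.stableNorms hX ha hb hα i.pos hl hR (q := 2 * k) (by omega) r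
  refine (_root_.eLpNorm_influenceDiff_le (by omega) hX hs hM (by positivity) i).trans
    (ENNReal.ofReal_le_ofReal ?_)
  have hN : (trainSize n V : ℝ) ≤ n := by exact_mod_cast Nat.sub_le _ _
  calc _ ≤ 2 * weibullMoment a b α (2 * k) +
        (n : ℝ) * ((n : ℝ)⁻¹ * εR * weibullMoment a b α (2 * k)) := by gcongr
    _ = _ := by field_simp

/-- The error of replacing `n ∇ᵢ R̂_cv` by its linearization in the products. -/
noncomputable def productError (V : ℕ) (P : Measure 𝒳) (X X' : Fin n → Ω → 𝒳)
    (L : Fin p → 𝒳 → (Fin (trainSize n V) → 𝒳) → ℝ) (i : Fin n) (r s : Fin p) (ω : Ω) : ℝ :=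
  (n : ℝ) ^ 2 * (nablaCV V X X' (L r) i ω * nablaCV V X X' (L s) i ω) -
    influenceDiff P X X' (L r) i ω * influenceDiff P X X' (L s) i ω

omit [IsProbabilityMeasure μ] in
theorem IsStableLoss.measurable_influenceDiff (hX : IsIIDSample μ P X₀ X X')
    (h : IsStableLoss V μ P X₀ X X' L a b α εl εR) (i : Fin n) (r : Fin p) :
    Measurable (influenceDiff P X X' (L r) i) :=
  ((measurable_influence (h.measurable_loss r)).comp (hX.measurable_data i)).sub
    ((measurable_influence (h.measurable_loss r)).comp (hX.measurable_copy i))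

theorem IsStableLoss.eLpNorm_productError_le (hX : IsIIDSample μ P X₀ X X')
    (h : IsStableLoss V μ P X₀ X X' L a b α εl εR) (ha : 0 < a) (hb : 0 < b) (hα : 0 < α)
    (hV : V ∣ n) (hl : 0 < εl) (hl1 : εl ≤ 1) (hR : 0 < εR) {k : ℕ} (hk : 1 ≤ k) (r s : Fin p)
    (i : Fin n) :
    eLpNorm (productError V P X X' L i r s) k μ ≤
      ENNReal.ofReal (480 * k ^ 2 * weibullMoment a b α (2 * k) ^ 2 * (εl * (1 + εR))) := by
  have hk1 : (1 : ℝ) ≤ k := by exact_mod_cast hk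
  have hk' : (1 : ℝ≥0∞) ≤ k := by exact_mod_cast hk
  have h2k' : (1 : ℝ≥0∞) ≤ ((2 * k : ℕ) : ℝ≥0∞) := by exact_mod_cast (by omega : 1 ≤ 2 * k)
  have hM := weibullMoment_nonneg ha hb hα (2 * k)
  set M := weibullMoment a b α (2 * k)
  set H : Fin p → Ω → ℝ := fun r => influenceDiff P X X' (L r) i with hH
  set D : Fin p → Ω → ℝ := fun r ω => n * nablaCV V X X' (L r) i ω - H r ω with hD
  have hHm : ∀ r, Measurable (H r) := h.measurable_influenceDiff hX i
  have hDm : ∀ r, Measurable (D r) := fun r =>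
    ((measurable_nablaCV hX (h.measurable_loss r) i).const_mul _).sub (hHm r)
  have hHb : ∀ r, eLpNorm (H r) ((2 * k : ℕ) : ℝ≥0∞) μ ≤ ENNReal.ofReal ((2 + εR) * M) :=
    fun r => h.eLpNorm_influenceDiff_le hX ha hb hα hl hR hk r i
  have hDb : ∀ r, eLpNorm (D r) ((2 * k : ℕ) : ℝ≥0∞) μ ≤ ENNReal.ofReal (20 * k * (εl * M)) :=
    fun r => h.eLpNorm_mul_nablaCV_sub_le hX ha hb hα hV hl hR hk r i
  have e : productError V P X X' L i r s =
      (fun ω => D r ω * (D s + H s) ω) + fun ω => H r ω * D s ω := by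
    ext ω
    simp only [productError, hD, hH, Pi.add_apply]
    ring
  have b1 : eLpNorm (D s + H s) ((2 * k : ℕ) : ℝ≥0∞) μ ≤
      ENNReal.ofReal (20 * k * (εl * M) + (2 + εR) * M) := by
    rw [ENNReal.ofReal_add (by positivity) (by positivity)]
    exact (eLpNorm_add_le (hDm s).aestronglyMeasurable (hHm s).aestronglyMeasurable h2k').trans
      (add_le_add (hDb s) (hHb s))
  rw [e]
  refine (eLpNorm_add_le ((hDm r).mul ((hDm s).add (hHm s))).aestronglyMeasurable
    ((hHm r).mul (hDm s)).aestronglyMeasurable hk').trans ?_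
  refine (add_le_add
    ((eLpNorm_mul_le_of_two_mul (hDm r).aestronglyMeasurable
      ((hDm s).add (hHm s)).aestronglyMeasurable k).trans (mul_le_mul' (hDb r) b1))
    ((eLpNorm_mul_le_of_two_mul (hHm r).aestronglyMeasurable
      (hDm s).aestronglyMeasurable k).trans (mul_le_mul' (hHb r) (hDb s)))).trans ?_
  rw [← ENNReal.ofReal_mul (by positivity), ← ENNReal.ofReal_mul (by positivity),
    ← ENNReal.ofReal_add (by positivity) (by positivity)]
  refine ENNReal.ofReal_le_ofReal ?_
  -- `εl ≤ 1` and `k ≥ 1` are needed here; the quadratic error term is then absorbed in the linear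
  -- one.
  have h1 : 20 * k * εl + 2 * (2 + εR) ≤ 24 * k * (1 + εR) := by nlinarith
  calc _ = 20 * k * M ^ 2 * εl * (20 * k * εl + 2 * (2 + εR)) := by ring
    _ ≤ 20 * k * M ^ 2 * εl * (24 * k * (1 + εR)) := by gcongr
    _ = _ := by ring

theorem IsStableLoss.memLp_nablaCV (hX : IsIIDSample μ P X₀ X X')
    (h : IsStableLoss V μ P X₀ X X' L a b α εl εR) (ha : 0 < a) (hb : 0 < b) (hα : 0 < α)
    (hV : V ∣ n) (hl : 0 < εl) (hR : 0 < εR) (r : Fin p) (i : Fin n) :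
    MemLp (nablaCV V X X' (L r) i) 2 μ := by
  have hn' : (n : ℝ) ≠ 0 := by exact_mod_cast i.pos.ne'
  have hs := h.stableNorms hX ha hb hα i.pos hl hR (q := 2 * 1) (by omega) r
  have h1 : MemLp (fun ω => n * nablaCV V X X' (L r) i ω - influenceDiff P X X' (L r) i ω)
      ((2 * 1 : ℕ) : ℝ≥0∞) μ :=
    ⟨(((measurable_nablaCV hX (h.measurable_loss r) i).const_mul _).sub
      (h.measurable_influenceDiff hX i r)).aestronglyMeasurable,
      (h.eLpNorm_mul_nablaCV_sub_le hX ha hb hα hV hl hR le_rfl r i).trans_lt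
        ENNReal.ofReal_lt_top⟩
  have h2 := (h1.add (memLp_influenceDiff (by omega) hX hs i)).const_mul (n : ℝ)⁻¹
  have e : (fun ω => (n : ℝ)⁻¹ * ((fun ω => n * nablaCV V X X' (L r) i ω -
      influenceDiff P X X' (L r) i ω) + influenceDiff P X X' (L r) i) ω) =
      nablaCV V X X' (L r) i := by
    ext ω
    simp only [Pi.add_apply]
    field_simp
    ring
  rw [e] at h2
  simpa using h2

theorem IsStableLoss.memLp_influence (hX : IsIIDSample μ P X₀ X X')
    (h : IsStableLoss V μ P X₀ X X' L a b α εl εR) (ha : 0 < a) (hb : 0 < b) (hα : 0 < α)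
    (hn : 0 < n) (hl : 0 < εl) (hR : 0 < εR) (r : Fin p) : MemLp (influence P (L r)) 2 P := by
  have hs := h.stableNorms hX ha hb hα hn hl hR (q := 2) (by omega) r
  simpa using hs.memLp_influence (by omega)

theorem IsStableLoss.integral_influenceDiff_mul (hX : IsIIDSample μ P X₀ X X')
    (h : IsStableLoss V μ P X₀ X X' L a b α εl εR) (ha : 0 < a) (hb : 0 < b) (hα : 0 < α)
    (hl : 0 < εl) (hR : 0 < εR) (i : Fin n) (r s : Fin p) :
    Integrable (fun ω => influenceDiff P X X' (L r) i ω * influenceDiff P X X' (L s) i ω) μ ∧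
    ∫ ω, influenceDiff P X X' (L r) i ω * influenceDiff P X X' (L s) i ω ∂μ =
      2 * phi P L r s := by
  have hf := h.memLp_influence hX ha hb hα i.pos hl hR
  have hH : ∀ r, MemLp (influenceDiff P X X' (L r) i) 2 μ := fun r =>
    ((hf r).comp_measurePreserving ⟨hX.measurable_data i, hX.law_data i⟩).sub
      ((hf r).comp_measurePreserving ⟨hX.measurable_copy i, hX.law_copy i⟩)
  refine ⟨(hH r).integrable_mul (hH s), ?_⟩
  rw [phi, ← two_mul_covariance_eq_integral (hf r) (hf s)]
  have hmp := hX.measurePreserving_data_copy i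
  have hm : ∀ r, Measurable (influence P (L r)) := fun r =>
    measurable_influence (h.measurable_loss r)
  rw [← hmp.map_eq, integral_map hmp.aemeasurable]
  · rfl
  · exact ((((hm r).comp measurable_fst).sub ((hm r).comp measurable_snd)).mul
      (((hm s).comp measurable_fst).sub ((hm s).comp measurable_snd))).aestronglyMeasurable

omit [IsProbabilityMeasure μ] [IsProbabilityMeasure P] in
theorem trainSigma_le (hX : IsIIDSample μ P X₀ X X') (i : Fin n) :
    trainSigma V X i ≤ (inferInstance : MeasurableSpace Ω) :=
  ((measurable_dropFold V _).comp
    (measurable_pi_lambda _ hX.measurable_data)).comap_le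

/-- The product of the linearizations is a function of `(X_i, X'_i)`, and `X_{-v_i}` omits the fold
of `i`. By independence its conditional expectation is the constant `2 φ_rs`. -/
theorem IsStableLoss.condExp_productError (hX : IsIIDSample μ P X₀ X X')
    (h : IsStableLoss V μ P X₀ X X' L a b α εl εR) (ha : 0 < a) (hb : 0 < b) (hα : 0 < α)
    (hV : V ∣ n) (hl : 0 < εl) (hR : 0 < εR) (i : Fin n) (r s : Fin p) :
    ∀ᵐ ω ∂μ, (μ[productError V P X X' L i r s | trainSigma V X i]) ω =
      (n : ℝ) ^ 2 * (μ[fun ω' => nablaCV V X X' (L r) i ω' * nablaCV V X X' (L s) i ω' |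
        trainSigma V X i]) ω - 2 * phi P L r s := by
  set Q : Ω → ℝ := fun ω' => nablaCV V X X' (L r) i ω' * nablaCV V X X' (L s) i ω' with hQ
  set HH : Ω → ℝ := fun ω => influenceDiff P X X' (L r) i ω * influenceDiff P X X' (L s) i ω
    with hHH
  have hQi : Integrable Q μ := (h.memLp_nablaCV hX ha hb hα hV hl hR r i).integrable_mul
    (h.memLp_nablaCV hX ha hb hα hV hl hR s i)
  obtain ⟨hHi, hHint⟩ := h.integral_influenceDiff_mul hX ha hb hα hl hR i r s
  have hle := trainSigma_le (V := V) hX i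
  have hmp := hX.measurePreserving_data_copy i
  have hind : IndepFun (fun ω => (X i ω, X' i ω))
      (fun ω => dropFold V (foldOf V i) fun k => X k ω) μ :=
    (hX.isIID.indepFun_comp
      (e := fun c : Bool => some (cond c (Sum.inl i) (Sum.inr i)))
      (e' := fun k => some (Sum.inl (trainIdx n V (foldOf V i) k))) (by
        intro c k
        cases c
        · simp
        · simpa using (trainIdx_ne_of_foldOf_eq hV rfl k).symm)).comp
      (φ := fun w => (w true, w false)) (ψ := id) (by fun_prop) measurable_id
  have hm : ∀ r, Measurable (influence P (L r)) := fun r =>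
    measurable_influence (h.measurable_loss r)
  have hgm : Measurable fun w : 𝒳 × 𝒳 => (influence P (L r) w.1 - influence P (L r) w.2) *
      (influence P (L s) w.1 - influence P (L s) w.2) :=
    (((hm r).comp measurable_fst).sub ((hm r).comp measurable_snd)).mul
      (((hm s).comp measurable_fst).sub ((hm s).comp measurable_snd))
  have hsm : StronglyMeasurable[MeasurableSpace.comap (fun ω => (X i ω, X' i ω)) inferInstance]
      HH := (hgm.comp (comap_measurable (fun ω => (X i ω, X' i ω)))).stronglyMeasurable
  have hc1 := condExp_indep_eq hmp.measurable.comap_le hle hsm ((IndepFun_iff_Indep _ _ _).1 hind)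
  have hc2 := condExp_sub (hQi.const_mul ((n : ℝ) ^ 2)) hHi (trainSigma V X i)
  have hc3 := condExp_smul ((n : ℝ) ^ 2) Q (trainSigma V X i) (μ := μ)
  filter_upwards [hc1, hc2, hc3] with ω w1 w2 w3
  have w2' : (μ[productError V P X X' L i r s | trainSigma V X i]) ω =
    (μ[(n : ℝ) ^ 2 • Q | trainSigma V X i]) ω - (μ[HH | trainSigma V X i]) ω := w2
  rw [w2', w1, w3, hHint]
  rfl

theorem IsStableLoss.integral_productError (hX : IsIIDSample μ P X₀ X X')
    (h : IsStableLoss V μ P X₀ X X' L a b α εl εR) (ha : 0 < a) (hb : 0 < b) (hα : 0 < α)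
    (hV : V ∣ n) (hl : 0 < εl) (hR : 0 < εR) (i : Fin n) (r s : Fin p) :
    ∫ ω, productError V P X X' L i r s ω ∂μ =
      (n : ℝ) ^ 2 * (∫ ω, nablaCV V X X' (L r) i ω * nablaCV V X X' (L s) i ω ∂μ) -
        2 * phi P L r s := by
  have hQi : Integrable (fun ω => nablaCV V X X' (L r) i ω * nablaCV V X X' (L s) i ω) μ :=
    (h.memLp_nablaCV hX ha hb hα hV hl hR r i).integrable_mul
      (h.memLp_nablaCV hX ha hb hα hV hl hR s i)
  obtain ⟨hHi, hHint⟩ := h.integral_influenceDiff_mul hX ha hb hα hl hR i r s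
  unfold productError
  rw [integral_sub (hQi.const_mul _) hHi, integral_const_mul, hHint]

theorem IsStableLoss.abs_integral_productError_le (hX : IsIIDSample μ P X₀ X X')
    (h : IsStableLoss V μ P X₀ X X' L a b α εl εR) (ha : 0 < a) (hb : 0 < b) (hα : 0 < α)
    (hV : V ∣ n) (hl : 0 < εl) (hl1 : εl ≤ 1) (hR : 0 < εR) (i : Fin n) (r s : Fin p) :
    |∫ ω, productError V P X X' L i r s ω ∂μ| ≤
      480 * weibullMoment a b α 2 ^ 2 * (εl * (1 + εR)) := by
  have h1 := h.eLpNorm_productError_le hX ha hb hα hV hl hl1 hR le_rfl r s i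
  have h2 : ‖∫ ω, productError V P X X' L i r s ω ∂μ‖ₑ ≤ _ :=
    (enorm_integral_le_lintegral_enorm _).trans_eq eLpNorm_one_eq_lintegral_enorm.symm
  rw [Nat.cast_one] at h1
  have h3 := h2.trans h1
  rw [Real.enorm_eq_ofReal_abs, ENNReal.ofReal_le_ofReal_iff (by positivity)] at h3
  simpa using h3

end Main

/-! ### Logarithmic moment order and the final assembly. -/

/-- The growth of `weibullMoment` at a logarithmic order. -/
theorem weibullMoment_sq_le {a b α A l : ℝ} (ha : 0 < a) (hb : 0 < b) (hα : 0 < α)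
    {k : ℕ} (hA : 0 < A) (hl : 0 < l) (hkl : (k : ℝ) ≤ A * l) :
    480 * (k : ℝ) ^ 2 * weibullMoment a b α (2 * k) ^ 2 ≤
      480 * A ^ 2 * (1 + a) ^ 2 * (4 * A / (α * b)) ^ (2 * α⁻¹) * l ^ (2 + 2 * α⁻¹) := by
  have h1 : weibullMoment a b α (2 * k) ≤ (1 + a) * (4 * A / (α * b) * l) ^ α⁻¹ := by
    unfold weibullMoment
    gcongr
    push_cast
    calc 2 * (2 * (k : ℝ)) / (α * b) ≤ 2 * (2 * (A * l)) / (α * b) := by gcongr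
      _ = _ := by ring
  have h0 := weibullMoment_nonneg ha hb hα (2 * k)
  calc _ ≤ 480 * (A * l) ^ 2 * ((1 + a) * (4 * A / (α * b) * l) ^ α⁻¹) ^ 2 := by gcongr
    _ = _ := by
      rw [Real.rpow_add hl, Real.rpow_two, mul_pow (1 + a), ← Real.rpow_mul_natCast (by positivity),
        mul_comm α⁻¹, Nat.cast_ofNat, Real.mul_rpow (by positivity) hl.le]
      ring

theorem mainTheorem5 (a b α : ℝ) (ha : 0 < a) (hb : 0 < b) (hα : 0 < α) :
    ∃ (C c₂ : ℝ) (c₁ : ℝ → ℝ), 0 < C ∧ 0 < c₂ ∧ (∀ κ, 0 < κ → 0 < c₁ κ) ∧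
      ∀ (Ω : Type*) (𝒳 : Type*) [MeasurableSpace Ω] [MeasurableSpace 𝒳]
        (μ : Measure Ω) [IsProbabilityMeasure μ] (P : Measure 𝒳) [IsProbabilityMeasure P]
        (n V p : ℕ) (_ : V ∣ n)
        (X₀ : Ω → 𝒳) (X X' : Fin n → Ω → 𝒳) (_ : IsIIDSample μ P X₀ X X')
        (L : Fin p → 𝒳 → (Fin (trainSize n V) → 𝒳) → ℝ)
        (cl εl εR : ℝ) (_ : 0 < cl) (_ : cl ≤ 1 / 2) (_ : εl = (n : ℝ) ^ (-cl)) (_ : 0 < εR)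
        (_ : IsStableLoss V μ P X₀ X X' L a b α εl εR) (i : Fin n),
        (∀ r, MemLp (influence P (L r)) 2 P) ∧
        (∀ r s, Integrable
          (fun ω => nablaCV V X X' (L r) i ω * nablaCV V X X' (L s) i ω) μ) ∧
        (∀ r s,
          |(n : ℝ) ^ 2 / 2 * (∫ ω, nablaCV V X X' (L r) i ω * nablaCV V X X' (L s) i ω ∂μ)
            - phi P L r s| ≤ C * (εl * (1 + εR))) ∧
        (∀ κ, 0 < κ →
          μ.real {ω | ∃ r s,
            c₁ κ * Real.log (n + p) ^ c₂ * (εl * (1 + εR)) <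
              (n : ℝ) ^ 2 *
                |(μ[fun ω' => nablaCV V X X' (L r) i ω' * nablaCV V X X' (L s) i ω' |
                    trainSigma V X i]) ω
                  - ∫ ω', nablaCV V X X' (L r) i ω' * nablaCV V X X' (L s) i ω' ∂μ|}
            ≤ ((n : ℝ) + p) ^ (-κ)) ∧
        (∀ κ, 0 < κ →
          μ.real {ω | ∃ r s,
            c₁ κ * Real.log (n + p) ^ c₂ * (εl * (1 + εR)) <
              |(n : ℝ) ^ 2 / 2 *
                (μ[fun ω' => nablaCV V X X' (L r) i ω' * nablaCV V X X' (L s) i ω' |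
                    trainSigma V X i]) ω
                - phi P L r s|}
            ≤ ((n : ℝ) + p) ^ (-κ)) := by
  set M₂ := weibullMoment a b α 2 with hM₂
  have hM₂pos : 0 < M₂ := by rw [hM₂]; unfold weibullMoment; positivity
  -- The product error grows like `k²` times the squared sub-Weibull moment, which is of order
  -- `k^{2/α}`; `k` will be of order `log(n + p)`.
  set c₂ : ℝ := 2 + 2 * α⁻¹ with hc₂
  have hlog2 : 0 < Real.log 2 := Real.log_pos (by norm_num)
  -- `κ` is for the probability, `2` pays for the `p²` pairs, and `1 / log 2` absorbs rounding the
  -- moment order up to an integer.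
  set A : ℝ → ℝ := fun κ => κ + 2 + (Real.log 2)⁻¹ with hA
  set K : ℝ → ℝ := fun κ =>
    480 * A κ ^ 2 * (1 + a) ^ 2 * (4 * A κ / (α * b)) ^ (2 * α⁻¹) with hK
  have hApos : ∀ κ, 0 < κ → 0 < A κ := fun κ hκ => by positivity
  have hKpos : ∀ κ, 0 < κ → 0 < K κ := fun κ hκ => by have := hApos κ hκ; positivity
  refine ⟨240 * M₂ ^ 2, c₂,
    -- The first summand bounds the conditional mean, the factor `e` coming from Markov's
    -- inequality. The second bounds the plain mean, a constant turned into a multiple of a power of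
    -- `log(n + p) ≥ log 2`.
    fun κ => Real.exp 1 * K κ + 480 * M₂ ^ 2 * (Real.log 2 ^ c₂)⁻¹,
    by positivity, by positivity, fun κ hκ => by have := hKpos κ hκ; positivity, ?_⟩
  intro Ω 𝒳 _ _ μ _ P _ n V p hV X₀ X X' hX L cl εl εR hcl _ hεl hR h i
  have hn1 : (1 : ℝ) ≤ n := by exact_mod_cast i.pos
  have hl : 0 < εl := by rw [hεl]; positivity
  have hl1 : εl ≤ 1 := by
    rw [hεl]; exact Real.rpow_le_one_of_one_le_of_nonpos hn1 (by linarith)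
  set e := εl * (1 + εR) with he
  have hepos : 0 < e := by positivity
  have hE : ∀ r s, |∫ ω, productError V P X X' L i r s ω ∂μ| ≤ 480 * M₂ ^ 2 * e := fun r s =>
    h.abs_integral_productError_le hX ha hb hα hV hl hl1 hR i r s
  have hEeq := h.integral_productError hX ha hb hα hV hl hR i
  have hCeq := ae_all_iff.2 fun r => ae_all_iff.2 fun s =>
    h.condExp_productError hX ha hb hα hV hl hR i r s
  have htail : ∀ κ, 0 < κ → ∃ B, (0 < p → B ≤ K κ * Real.log (n + p) ^ c₂ * e) ∧
      μ.real {ω | ∃ r s, Real.exp 1 * B ≤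
        |(μ[productError V P X X' L i r s | trainSigma V X i]) ω|} ≤ ((n : ℝ) + p) ^ (-κ) ∧
      (0 < p → 480 * M₂ ^ 2 ≤
        480 * M₂ ^ 2 * (Real.log 2 ^ c₂)⁻¹ * Real.log (n + p) ^ c₂) := by
    intro κ hκ
    have hAκ := hApos κ hκ
    -- For `p = 0` the event is empty, and `log(n + p)` may vanish (at `n = 1`), so the choice of
    -- `k` below needs `p ≥ 1`; the value 1 of `B` is a dummy.
    rcases p.eq_zero_or_pos with rfl | hp
    · refine ⟨1, fun h => absurd h (lt_irrefl _), ?_, fun h => absurd h (lt_irrefl _)⟩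
      have : {ω | ∃ r s : Fin 0, Real.exp 1 * 1 ≤
          |(μ[productError V P X X' L i r s | trainSigma V X i]) ω|} = ∅ := by
        ext ω; simp
      rw [this, measureReal_empty]
      positivity
    have hp1 : (1 : ℝ) ≤ p := by exact_mod_cast hp
    have hnp : (2 : ℝ) ≤ n + p := by linarith
    have hnp0 : (0 : ℝ) < n + p := by linarith
    set l := Real.log (n + p) with hldef
    have hl2 : Real.log 2 ≤ l := Real.log_le_log (by norm_num) hnp
    have hlpos : 0 < l := hlog2.trans_le hl2
    set k := ⌈(κ + 2) * l⌉₊ with hkdef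
    have hk : 1 ≤ k := Nat.one_le_ceil_iff.2 (by positivity)
    have hk0 : (0 : ℝ) < k := by exact_mod_cast hk
    have hkl : (κ + 2) * l ≤ k := Nat.le_ceil _
    have hkA : (k : ℝ) ≤ A κ * l := by
      have h1 := (Nat.ceil_lt_add_one (by positivity : 0 ≤ (κ + 2) * l)).le
      have h2 : 1 ≤ (Real.log 2)⁻¹ * l := by
        rw [inv_mul_eq_div, le_div_iff₀ hlog2, one_mul]; exact hl2
      calc (k : ℝ) ≤ (κ + 2) * l + 1 := h1
        _ ≤ (κ + 2) * l + (Real.log 2)⁻¹ * l := by gcongr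
        _ = _ := by ring
    have hMk : 0 < weibullMoment a b α (2 * k) := by
      unfold weibullMoment; positivity
    refine ⟨480 * k ^ 2 * weibullMoment a b α (2 * k) ^ 2 * e, fun _ => ?_, ?_, fun _ => ?_⟩
    · exact mul_le_mul_of_nonneg_right (weibullMoment_sq_le ha hb hα hAκ hlpos hkA) hepos.le
    · refine (measureReal_exists_exp_mul_le hk (by positivity)
        (fun r s => integrable_condExp.aestronglyMeasurable) fun r s =>
        -- Conditional expectation is an `L^k` contraction, so the bound on `productError` applies
        -- unchanged.
        (eLpNorm_condExp_le_eLpNorm _ (by exact_mod_cast hk)).trans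
          (h.eLpNorm_productError_le hX ha hb hα hV hl hl1 hR hk r s i)).trans ?_
      have h1 : (p : ℝ) ^ 2 ≤ ((n : ℝ) + p) ^ (2 : ℝ) := by
        rw [Real.rpow_two]; gcongr; linarith
      have h2 : Real.exp (-k) ≤ ((n : ℝ) + p) ^ (-(κ + 2)) := by
        rw [Real.rpow_def_of_pos hnp0]
        exact Real.exp_le_exp.2 (by linarith)
      calc _ ≤ ((n : ℝ) + p) ^ (2 : ℝ) * ((n : ℝ) + p) ^ (-(κ + 2)) := by gcongr
        _ = _ := by rw [← Real.rpow_add hnp0]; congr 1; ring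
    · rw [mul_assoc]
      refine le_mul_of_one_le_right (by positivity) ?_
      rw [inv_mul_eq_div, le_div_iff₀ (by positivity), one_mul]
      gcongr
  have hmono : ∀ (κ : ℝ) (S : Set Ω) (B : ℝ),
      μ.real {ω | ∃ r s, Real.exp 1 * B ≤
        |(μ[productError V P X X' L i r s | trainSigma V X i]) ω|} ≤ ((n : ℝ) + p) ^ (-κ) →
      (∀ᵐ ω ∂μ, ω ∈ S → ∃ r s, Real.exp 1 * B ≤
        |(μ[productError V P X X' L i r s | trainSigma V X i]) ω|) →
      μ.real S ≤ ((n : ℝ) + p) ^ (-κ) := fun κ S B h1 h2 =>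
    (ENNReal.toReal_mono (measure_ne_top μ _) (measure_mono_ae h2)).trans h1
  refine ⟨h.memLp_influence hX ha hb hα i.pos hl hR,
    fun r s => (h.memLp_nablaCV hX ha hb hα hV hl hR r i).integrable_mul
      (h.memLp_nablaCV hX ha hb hα hV hl hR s i), fun r s => ?_, fun κ hκ => ?_, fun κ hκ => ?_⟩
  · have h1 := hE r s
    rw [hEeq r s] at h1
    rw [abs_le] at h1 ⊢
    constructor <;> linarith [h1.1, h1.2]
  · obtain ⟨B, hB, hBt, hp⟩ := htail κ hκ
    refine hmono κ _ B hBt ?_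
    filter_upwards [hCeq] with ω hω
    rintro ⟨r, s, hrs⟩
    refine ⟨r, s, ?_⟩
    have h1 := hE r s
    have h2 := mul_le_mul_of_nonneg_right (hp r.pos) hepos.le
    have h3 := mul_le_mul_of_nonneg_left (hB r.pos) (Real.exp_pos 1).le
    have e1 : (n : ℝ) ^ 2 * |(μ[fun ω' => nablaCV V X X' (L r) i ω' * nablaCV V X X' (L s) i ω' |
          trainSigma V X i]) ω
        - ∫ ω', nablaCV V X X' (L r) i ω' * nablaCV V X X' (L s) i ω' ∂μ| =
        |(μ[productError V P X X' L i r s | trainSigma V X i]) ω -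
          ∫ ω, productError V P X X' L i r s ω ∂μ| := by
      rw [hω r s, hEeq r s, ← abs_of_nonneg (sq_nonneg (n : ℝ)), ← abs_mul,
        abs_of_nonneg (sq_nonneg (n : ℝ))]
      congr 1
      ring
    rw [e1] at hrs
    have h4 := abs_sub ((μ[productError V P X X' L i r s | trainSigma V X i]) ω)
      (∫ ω, productError V P X X' L i r s ω ∂μ)
    linarith
  · obtain ⟨B, hB, hBt, hp⟩ := htail κ hκ
    refine hmono κ _ B hBt ?_
    filter_upwards [hCeq] with ω hω
    rintro ⟨r, s, hrs⟩
    refine ⟨r, s, ?_⟩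
    have h2 := mul_le_mul_of_nonneg_right (hp r.pos) hepos.le
    have h3 := mul_le_mul_of_nonneg_left (hB r.pos) (Real.exp_pos 1).le
    have h5 : 0 ≤ 480 * M₂ ^ 2 * e := by positivity
    have e1 : |(n : ℝ) ^ 2 / 2 *
          (μ[fun ω' => nablaCV V X X' (L r) i ω' * nablaCV V X X' (L s) i ω' |
            trainSigma V X i]) ω - phi P L r s| =
        |(μ[productError V P X X' L i r s | trainSigma V X i]) ω| / 2 := by
      -- The deviation is exactly half the conditional mean of `productError`, so `c₁` has room to
      -- spare.
      rw [hω r s, ← abs_of_pos (two_pos (α := ℝ)), ← abs_div, abs_of_pos (two_pos (α := ℝ))]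
      congr 1
      ring
    rw [e1] at hrs
    have h6 := abs_nonneg ((μ[productError V P X X' L i r s | trainSigma V X i]) ω)
    linarith
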